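/- Let $d\in\mathbb N$, let $|\cdot|$ be the Euclidean norm on $\mathbb R^d$, let $x^\dagger\in\mathbb R^d$, and let $G:\mathbb R^d\to\mathbb R^d$ and $V_0:\mathbb R^d\to\mathbb R$ satisfy the following. - $G\in C^4(\mathbb R^d;\mathbb R^d)$; $G(x)=G(x^\dagger)$ implies $x=x^\dagger$; and $G$ is a $C^1$-diffeomorphism from some neighbourhood of $x^\dagger$ onto its open image. - $V_0\in C^2(\mathbb R^d)$ and $\int_{\mathbb R^d}e^{-V_0(x)}\,dx<\infty$, so that $\mu_0(dx)\propto e^{-V_0(x)}dx$ is a probability measure (the prior). - There is $M>0$ with $\tfrac12|G(x^\dagger)-G(x)|^2\le M e^{|x|^2}$ and $|V_0(x)|\le M e^{|x|^2}$ for all $x\in\mathbb R^d$. - There are $c_0,c_1>0$ with $\tfrac12|G(x^\dagger)-G(x)|^2\ge -c_0+c_1|x|^2$ for all $x\in\mathbb R^d$. For $\varepsilon>0$ and $\eta\in\mathbb R^d$ consider the data $y=G(x^\dagger)+\sqrt\varepsilon\,\eta$ and the posterior $$\mu_\varepsilon^\eta(dx)=\frac1{Z^\eta_{\mu,\varepsilon}}\exp\Big(-\frac1{2\varepsilon}\big|G(x^\dagger)-G(x)+\sqrt\varepsilon\,\eta\big|^2-V_0(x)\Big)dx,$$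 where $Z^\eta_{\mu,\varepsilon}$ is the normalization constant. Let $\mathcal A$ be the set of all Gaussian measures $N(m,\Sigma)$ on $\mathbb R^d$ with $m\in\mathbb R^d$ and $\Sigma$ symmetric positive semidefinite, and for each $\eta$ let $\nu_\varepsilon^\eta\in\mathcal A$ be a best Gaussian approximation, that is, a minimizer over $\nu\in\mathcal A$ of the Kullback–Leibler divergence $D_{\mathrm{KL}}(\nu\|\mu_\varepsilon^\eta)=\mathbb E^\nu\log\frac{d\nu}{d\mu_\varepsilon^\eta}$ (with value $+\infty$ if $\nu\not\ll\mu_\varepsilon^\eta$). Then there exist $C>0$ and $\varepsilon_0>0$ such that for every $\varepsilon\in(0,\varepsilon_0)$ and every such choice of minimizers $(\nu_\varepsilon^\eta)_{\eta\in\mathbb R^d}$ the function $\eta\mapsto D_{\mathrm{KL}}(\nu_\varepsilon^\eta\|\mu_\varepsilon^\eta)$ is measurable and $$\mathbb E^{\eta}\,D_{\mathrm{KL}}(\nu_\varepsilon^\eta\,\|\,\mu_\varepsilon^\eta)\le C\varepsilon,$$ where $\mathbb E^\eta$ is the expectation over $\eta\sim N(0,I_d)$. -/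

import Mathlib

open MeasureTheory ProbabilityTheory InformationTheory Set
open scoped ENNReal Manifold ContDiff

noncomputable section

namespace GaussianKL

/-- The Euclidean space `ℝ^d`. -/
abbrev Euc (d : ℕ) : Type := EuclideanSpace ℝ (Fin d)

variable {d : ℕ}

/-- The data `y = G(x†) + √ε η` produced by the truth `xt` and the noise `η`. -/
def data (G : Euc d → Euc d) (xt : Euc d) (ε : ℝ) (η : Euc d) : Euc d :=
  G xt + Real.sqrt ε • η

/-- The unnormalised posterior density
`x ↦ exp (-|y - G(x)|² / (2ε) - V₀(x))` for the data `y = G(x†) + √ε η`. -/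
def posteriorWeight (G : Euc d → Euc d) (V₀ : Euc d → ℝ) (xt : Euc d) (ε : ℝ) (η : Euc d)
    (x : Euc d) : ℝ :=
  Real.exp (-(1 / (2 * ε)) * ‖data G xt ε η - G x‖ ^ 2 - V₀ x)

/-- The normalisation constant `Z` of the posterior. -/
def posteriorZ (G : Euc d → Euc d) (V₀ : Euc d → ℝ) (xt : Euc d) (ε : ℝ) (η : Euc d) : ℝ :=
  ∫ x, posteriorWeight G V₀ xt ε η x

/-- The posterior `μ_ε^η`: the measure with Lebesgue density
`Z⁻¹ exp (-|y - G(x)|² / (2ε) - V₀(x))`. -/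
def posterior (G : Euc d → Euc d) (V₀ : Euc d → ℝ) (xt : Euc d) (ε : ℝ) (η : Euc d) :
    Measure (Euc d) :=
  volume.withDensity fun x =>
    ENNReal.ofReal (posteriorWeight G V₀ xt ε η x / posteriorZ G V₀ xt ε η)

/-- The set `𝒜` of all Gaussian measures `N(m, S)` on `ℝ^d`, `m ∈ ℝ^d`, with `S` symmetric
positive semidefinite (degenerate Gaussians included). -/
def gaussianMeasures (d : ℕ) : Set (Measure (Euc d)) :=
  {ν | ∃ (m : Euc d) (S : Matrix (Fin d) (Fin d) ℝ),
    S.PosSemidef ∧ ν = multivariateGaussian m S}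

/-- `ν` is a best Gaussian approximation of `μ`: it minimises `ν' ↦ D_KL(ν' ‖ μ)` over all
Gaussian measures. -/
def IsBestGaussian (ν μ : Measure (Euc d)) : Prop :=
  ν ∈ gaussianMeasures d ∧ ∀ ν' ∈ gaussianMeasures d, klDiv ν μ ≤ klDiv ν' μ

end GaussianKL

end

noncomputable section

namespace GaussianKL

variable {d : ℕ}

/-! ### Divergence of measures with densities, and rescaling of the reference measure -/

section KL
variable {α : Type*} [MeasurableSpace α] {l : Measure α}

/-! Write s = √ε and A = DG(x†), with inverse A'. By minimality a single competitor suffices: the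
law of x† + s A'(η + ξ), ξ standard Gaussian, which is the posterior of the model linearised at x†
under a flat prior. Its density is proportional to exp(-|η - b|²/2) with b = s⁻¹A(x - x†), while the
true posterior is proportional to exp(-|η - g|²/2 - V₀(x)) with g = s⁻¹(G(x) - G(x†)).

Two devices give the order s² = ε. By `klDiv_le_klDiv_smul_right` the posterior may be replaced by
any positive multiple of itself, so its normalisation is never expanded. With the multiple chosen so
that the density ratio is e^W, W = `misfitGap`, the integrand is the competitor's density times
e^(-W) - 1 + W (`klDiv_linearised_le`): the term linear in W has cancelled and a quadratic one
remains.

Averaging over η turns the weight into a Gaussian in (η, ζ), ζ = (x - x†)/s. Near x†, Taylor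
expansion gives |W| ≤ s · polynomial, hence a contribution O(s²) (`exists_near_bound`). Away from
x†, |ζ| ≥ δ/s and |g|² ≥ κ/s², so both weights are tiny, and for small s Gaussian decay absorbs the
e^(|x|²) growth (`exists_far_bound`).

Measurability is separate: the minimum is at most c exactly when some Gaussian achieves at most c,
and the set of such η is a projection of σ-compact sets. -/

lemma ofReal_mul_klFun {p q : ℝ} (hp : 0 ≤ p) (hq : 0 < q) :
    ENNReal.ofReal q * ENNReal.ofReal (klFun (ENNReal.ofReal (p / q)).toReal) =
      ENNReal.ofReal (q * klFun (p / q)) := by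
  rw [ENNReal.toReal_ofReal (by positivity), ← ENNReal.ofReal_mul hq.le]

lemma withDensity_ofReal_eq_withDensity_div {p q : α → ℝ} (hp : Measurable p) (hq : Measurable q)
    (hq0 : ∀ x, 0 < q x) :
    l.withDensity (fun x => ENNReal.ofReal (p x)) =
      (l.withDensity fun x => ENNReal.ofReal (q x)).withDensity
        (fun x => ENNReal.ofReal (p x / q x)) := by
  rw [← withDensity_mul _ (by fun_prop) (by fun_prop)]
  congr 1
  ext x
  simp only [Pi.mul_apply]
  rw [← ENNReal.ofReal_mul (hq0 x).le, mul_div_cancel₀ _ (hq0 x).ne']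

/-- The Kullback–Leibler divergence of measures given by densities. -/
lemma klDiv_withDensity_ofReal {p q : α → ℝ} (hp : Measurable p) (hq : Measurable q)
    (hp0 : ∀ x, 0 ≤ p x) (hq0 : ∀ x, 0 < q x)
    [IsFiniteMeasure (l.withDensity fun x => ENNReal.ofReal (p x))]
    [IsFiniteMeasure (l.withDensity fun x => ENNReal.ofReal (q x))] :
    klDiv (l.withDensity fun x => ENNReal.ofReal (p x))
      (l.withDensity fun x => ENNReal.ofReal (q x)) =
      ∫⁻ x, ENNReal.ofReal (q x * klFun (p x / q x)) ∂l := by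
  have h := withDensity_ofReal_eq_withDensity_div (l := l) hp hq hq0
  have hac : l.withDensity (fun x => ENNReal.ofReal (p x)) ≪
      l.withDensity (fun x => ENNReal.ofReal (q x)) := by
    rw [h]; exact withDensity_absolutelyContinuous _ _
  rw [klDiv_eq_lintegral_klFun_of_ac hac]
  have hr : (l.withDensity fun x => ENNReal.ofReal (p x)).rnDeriv
      (l.withDensity fun x => ENNReal.ofReal (q x)) =ᵐ[l.withDensity
        (fun x => ENNReal.ofReal (q x))] fun x => ENNReal.ofReal (p x / q x) := by
    nth_rw 1 [h]
    exact Measure.rnDeriv_withDensity _ (by fun_prop)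
  rw [lintegral_congr_ae (hr.mono fun x hx => by rw [hx]),
    lintegral_withDensity_eq_lintegral_mul _ (by fun_prop) (by fun_prop)]
  exact lintegral_congr fun x => ofReal_mul_klFun (hp0 x) (hq0 x)

/-- With the mass term built into `klDiv`, passing from μ to cμ changes the divergence by c - 1 -
log c ≥ 0. This is what spares any estimate of the posterior's normalising constant. -/
lemma klDiv_le_klDiv_smul_right {μ ν : Measure α} [IsProbabilityMeasure μ]
    [IsProbabilityMeasure ν] {c : NNReal} (hc : c ≠ 0) : klDiv ν μ ≤ klDiv ν (c • μ) := by
  by_cases h : klDiv ν (c • μ) = ⊤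
  · simp [h]
  have hc' : (c : ℝ≥0∞) ≠ 0 := by simpa using hc
  have h1 := klDiv_ne_top_iff.1 h
  have hac : ν ≪ μ := h1.1.trans Measure.smul_absolutelyContinuous
  have hint : Integrable (llr ν μ) ν := by
    have h2 := llr_smul_right hac (c : ℝ≥0∞) hc' (by simp)
    have h3 := h1.2
    rw [← Measure.coe_nnreal_smul, integrable_congr h2] at h3
    exact (h3.add (integrable_const (Real.log (c : ℝ≥0∞).toReal))).congr
      (ae_of_all _ fun x => by simp)
  have h4 := toReal_klDiv_smul_right hac hint hc
  rw [← ENNReal.toReal_le_toReal (klDiv_ne_top hac hint) h, h4]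
  simp only [probReal_univ, mul_one]
  have := Real.log_le_sub_one_of_pos (NNReal.coe_pos.2 (pos_iff_ne_zero.2 hc))
  linarith

end KL

/-! ### Gaussian measures as affine images of the standard Gaussian -/

section Density

/-- The normalisation constant of the standard Gaussian density on `ℝ^d`. -/
def stdConst (d : ℕ) : ℝ := ((2 * Real.pi) ^ ((d : ℝ) / 2))⁻¹

lemma stdConst_pos (d : ℕ) : 0 < stdConst d := by unfold stdConst; positivity

lemma integrable_exp_neg_mul_sq_norm {b : ℝ} (hb : 0 < b) :
    Integrable (fun x : Euc d => Real.exp (-b * ‖x‖ ^ 2)) := by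
  have h := GaussianFourier.integrable_cexp_neg_mul_sq_norm_add (V := Euc d) (b := (b : ℂ))
    (by simpa using hb) 0 0
  refine h.re.congr (ae_of_all _ fun x => ?_)
  have : (-(b : ℂ) * (‖x‖ : ℂ) ^ 2 + 0 * ((inner ℝ (0 : Euc d) x : ℝ) : ℂ)) =
    ((-b * ‖x‖ ^ 2 : ℝ) : ℂ) := by push_cast; ring
  simp only [this]
  exact Complex.exp_ofReal_re _

lemma integral_exp_neg_mul_sq_norm {b : ℝ} (hb : 0 < b) :
    ∫ x : Euc d, Real.exp (-b * ‖x‖ ^ 2) = (Real.pi / b) ^ ((d : ℝ) / 2) := by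
  rw [GaussianFourier.integral_rexp_neg_mul_sq_norm hb]
  simp

lemma stdGaussian_eq_withDensity :
    stdGaussian (Euc d) = volume.withDensity
      (fun x => ENNReal.ofReal (stdConst d * Real.exp (-(1 / 2) * ‖x‖ ^ 2))) := by
  have hfin := isFiniteMeasure_withDensity_ofReal
    ((integrable_exp_neg_mul_sq_norm (d := d) (b := 1 / 2) (by norm_num)).const_mul
      (stdConst d)).2
  apply Measure.ext_of_charFun
  ext t
  rw [charFun_stdGaussian, charFun_apply,
    integral_withDensity_eq_integral_toReal_smul₀ (by fun_prop) (by simp)]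
  have h := GaussianFourier.integral_cexp_neg_mul_sq_norm_add (V := Euc d) (b := 1 / 2)
    (by norm_num) Complex.I t
  have e : ∀ x : Euc d, (ENNReal.ofReal (stdConst d * Real.exp (-(1 / 2) * ‖x‖ ^ 2))).toReal •
      Complex.exp ((inner ℝ x t : ℝ) * Complex.I) = (stdConst d : ℂ) *
      Complex.exp (-(1 / 2) * (‖x‖ : ℂ) ^ 2 + Complex.I * (inner ℝ t x : ℝ)) := by
    intro x
    rw [ENNReal.toReal_ofReal (mul_pos (stdConst_pos d) (Real.exp_pos _)).le, Complex.real_smul,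
      Complex.exp_add, real_inner_comm]
    push_cast
    rw [mul_comm Complex.I]
    ring
  simp_rw [e]
  rw [integral_const_mul, h, ← mul_assoc]
  have h1 : (stdConst d : ℂ) * ((Real.pi : ℂ) / (1 / 2)) ^ ((Module.finrank ℝ (Euc d) : ℂ) / 2)
      = 1 := by
    have : ((Real.pi : ℂ) / (1 / 2)) = ((2 * Real.pi : ℝ) : ℂ) := by push_cast; ring
    rw [this, finrank_euclideanSpace_fin,
      show ((d : ℂ) / 2) = (((d : ℝ) / 2 : ℝ) : ℂ) by push_cast; ring,
      ← Complex.ofReal_cpow (by positivity), stdConst, ← Complex.ofReal_mul,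
      inv_mul_cancel₀ (by positivity), Complex.ofReal_one]
  rw [h1, one_mul]
  congr 1
  rw [Complex.I_sq]
  ring

/-- The density of the law of `m + T ξ`, with `ξ` standard Gaussian, in terms of `B = T⁻¹`. -/
def gaussDens (m : Euc d) (B : Euc d →L[ℝ] Euc d) (x : Euc d) : ℝ :=
  |B.det| * (stdConst d * Real.exp (-(1 / 2) * ‖B (x - m)‖ ^ 2))

lemma gaussDens_nonneg (m : Euc d) (B : Euc d →L[ℝ] Euc d) (x : Euc d) :
    0 ≤ gaussDens m B x := by
  have := stdConst_pos d
  unfold gaussDens; positivity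

lemma continuous_gaussDens_comp {X : Type*} [TopologicalSpace X] {m : X → Euc d}
    {B : X → Euc d →L[ℝ] Euc d} {g : X → Euc d} (hm : Continuous m) (hB : Continuous B)
    (hg : Continuous g) : Continuous fun x => gaussDens (m x) (B x) (g x) := by
  unfold gaussDens
  have h1 : Continuous fun x => (B x).det := ContinuousLinearMap.continuous_det.comp hB
  fun_prop

lemma measurable_gaussDens (m : Euc d) (B : Euc d →L[ℝ] Euc d) : Measurable (gaussDens m B) :=
  (continuous_gaussDens_comp continuous_const continuous_const continuous_id).measurable

lemma det_mul_det_eq_one {B T : Euc d →L[ℝ] Euc d} (h : B * T = 1) : B.det * T.det = 1 := by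
  have : LinearMap.det ((B : Euc d →ₗ[ℝ] Euc d) * (T : Euc d →ₗ[ℝ] Euc d)) = 1 := by
    rw [show (B : Euc d →ₗ[ℝ] Euc d) * (T : Euc d →ₗ[ℝ] Euc d) = 1 from
      congrArg (fun L : Euc d →L[ℝ] Euc d => (L : Euc d →ₗ[ℝ] Euc d)) h]
    simp
  rwa [map_mul] at this

lemma exists_inverse_of_det_ne_zero {T : Euc d →L[ℝ] Euc d} (h : T.det ≠ 0) :
    ∃ B : Euc d →L[ℝ] Euc d, B * T = 1 := by
  refine ⟨((T.toContinuousLinearEquivOfDetNeZero h).symm : Euc d →L[ℝ] Euc d), ?_⟩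
  ext1 x
  exact (T.toContinuousLinearEquivOfDetNeZero h).symm_apply_apply x

lemma map_stdGaussian_eq_withDensity (m : Euc d) {B T : Euc d →L[ℝ] Euc d} (h : B * T = 1) :
    (stdGaussian (Euc d)).map (fun x => m + T x) =
      volume.withDensity (fun x => ENNReal.ofReal (gaussDens m B x)) := by
  have hdet := det_mul_det_eq_one h
  have hT : LinearMap.det (T : Euc d →ₗ[ℝ] Euc d) ≠ 0 := right_ne_zero_of_mul_eq_one hdet
  have hBT : ∀ x, B (T x) = x := fun x => congrArg (fun L : Euc d →L[ℝ] Euc d => L x) h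
  have hvol : (volume : Measure (Euc d)).map (fun x => m + T x) =
      ENNReal.ofReal |B.det| • volume := by
    have h1 := Measure.map_linearMap_addHaar_eq_smul_addHaar (volume : Measure (Euc d)) hT
    have h2 : (LinearMap.det (T : Euc d →ₗ[ℝ] Euc d))⁻¹ = B.det :=
      (eq_inv_of_mul_eq_one_left hdet).symm
    rw [h2] at h1
    rw [show (fun x => m + T x) = (fun x => m + x) ∘ (T : Euc d →ₗ[ℝ] Euc d) from rfl,
      ← Measure.map_map (measurable_const_add m) (f := ⇑(T : Euc d →ₗ[ℝ] Euc d))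
        T.continuous.measurable, h1, Measure.map_smul,
      map_add_left_eq_self]
  rw [stdGaussian_eq_withDensity]
  ext s hs
  have hm : Measurable (fun x => m + T x) := by fun_prop
  rw [Measure.map_apply hm hs, withDensity_apply _ (hm hs), withDensity_apply _ hs]
  have e : ∀ x, ENNReal.ofReal (stdConst d * Real.exp (-(1 / 2) * ‖x‖ ^ 2)) =
      (fun y => ENNReal.ofReal (stdConst d * Real.exp (-(1 / 2) * ‖B (y - m)‖ ^ 2)))
        (m + T x) := by
    intro x; simp [hBT]
  rw [lintegral_congr e, ← setLIntegral_map (f := fun y => ENNReal.ofReal (stdConst d *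
    Real.exp (-(1 / 2) * ‖B (y - m)‖ ^ 2))) hs (by fun_prop) hm, hvol, Measure.restrict_smul,
    lintegral_smul_measure, smul_eq_mul, ← lintegral_const_mul _ (by fun_prop)]
  refine lintegral_congr fun x => ?_
  rw [← ENNReal.ofReal_mul (abs_nonneg _)]
  rfl

/-- The image lives on a translate of a proper subspace, a Lebesgue null set. Degenerate Gaussians
therefore have infinite divergence. -/
lemma not_absolutelyContinuous_map_stdGaussian (m : Euc d) {T : Euc d →L[ℝ] Euc d}
    (h : T.det = 0) : ¬ (stdGaussian (Euc d)).map (fun x => m + T x) ≪ volume := by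
  intro hac
  have hm : Measurable (fun x => m + T x) := by fun_prop
  have hr : LinearMap.range (T : Euc d →ₗ[ℝ] Euc d) ≠ ⊤ :=
    (LinearMap.range_lt_top_of_det_eq_zero h).ne
  have h0 : volume ((fun y => -m + y) ⁻¹' (LinearMap.range (T : Euc d →ₗ[ℝ] Euc d) :
      Set (Euc d))) = 0 := by
    rw [measure_preimage_add]
    exact Measure.addHaar_submodule _ _ hr
  have h1 := hac h0
  have hms : MeasurableSet ((fun y => -m + y) ⁻¹' (LinearMap.range (T : Euc d →ₗ[ℝ] Euc d) :
      Set (Euc d))) :=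
    (measurable_const_add (-m)) (Submodule.closed_of_finiteDimensional _).measurableSet
  rw [Measure.map_apply hm hms] at h1
  have h2 : (fun x => m + T x) ⁻¹' ((fun y => -m + y) ⁻¹'
      (LinearMap.range (T : Euc d →ₗ[ℝ] Euc d) : Set (Euc d))) = univ := by
    ext x; simp
  rw [h2, measure_univ] at h1
  exact one_ne_zero h1

/-- The characteristic function sees T only through T T*, so T need not be the symmetric root of the
covariance; the competitor's s A' generally is not. -/
lemma map_stdGaussian_mem_gaussianMeasures (m : Euc d) (T : Euc d →L[ℝ] Euc d) :
    (stdGaussian (Euc d)).map (fun x => m + T x) ∈ gaussianMeasures d := by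
  set M : Matrix (Fin d) (Fin d) ℝ := (Matrix.toEuclideanCLM (n := Fin d) (𝕜 := ℝ)).symm T
    with hM
  have hS : (M * M.conjTranspose).PosSemidef := Matrix.posSemidef_self_mul_conjTranspose M
  refine ⟨m, M * M.conjTranspose, hS, ?_⟩
  have hTM : Matrix.toEuclideanCLM (n := Fin d) (𝕜 := ℝ) M = T := by simp [hM]
  have : IsProbabilityMeasure ((stdGaussian (Euc d)).map (fun x => m + T x)) :=
    Measure.isProbabilityMeasure_map (by fun_prop)
  apply Measure.ext_of_charFun
  ext t
  rw [charFun_multivariateGaussian hS, ← Matrix.inner_toEuclideanCLM, map_mul,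
    ← Matrix.star_eq_conjTranspose, map_star, hTM, charFun_apply,
    integral_map (by fun_prop) (by fun_prop)]
  have e : ∀ x, Complex.exp ((inner ℝ (m + T x) t : ℝ) * Complex.I) =
      Complex.exp ((inner ℝ t m : ℝ) * Complex.I) *
        Complex.exp ((inner ℝ x (ContinuousLinearMap.adjoint T t) : ℝ) * Complex.I) := by
    intro x
    rw [← Complex.exp_add, inner_add_left, ContinuousLinearMap.adjoint_inner_right,
      real_inner_comm]
    push_cast
    ring_nf
  simp_rw [e]
  rw [integral_const_mul, ← charFun_apply, charFun_stdGaussian, ← Complex.exp_add]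
  congr 1
  have : inner ℝ t ((T * star T) t) = ‖ContinuousLinearMap.adjoint T t‖ ^ 2 := by
    rw [← real_inner_self_eq_norm_sq, ContinuousLinearMap.star_eq_adjoint,
      ContinuousLinearMap.adjoint_inner_left]
    rfl
  rw [this]
  push_cast
  ring

lemma exists_map_of_mem_gaussianMeasures {ν : Measure (Euc d)} (h : ν ∈ gaussianMeasures d) :
    ∃ (m : Euc d) (T : Euc d →L[ℝ] Euc d), ν = (stdGaussian (Euc d)).map (fun x => m + T x) := by
  obtain ⟨m, S, -, rfl⟩ := h
  exact ⟨m, _, rfl⟩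

end Density

/-! ### Measurability of the minimal divergence in the noise -/

section Measurability
open Filter Topology

/-- Sublevel sets of a parametrised integral of nonnegative functions are closed when the
integrand depends continuously on the parameter (Fatou). -/
lemma isClosed_setOf_lintegral_le {X α : Type*} [PseudoMetricSpace X] [MeasurableSpace α]
    {l : Measure α} {f : X → α → ℝ≥0∞} (hf : ∀ x, Measurable (f x))
    (hc : ∀ a, Continuous fun x => f x a) (c : ℝ≥0∞) :
    IsClosed {x | ∫⁻ a, f x a ∂l ≤ c} := by
  refine IsSeqClosed.isClosed fun u x hu hx => ?_
  have h1 : ∀ a, liminf (fun n => f (u n) a) atTop = f x a := fun a =>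
    (((hc a).tendsto x).comp hx).liminf_eq
  calc ∫⁻ a, f x a ∂l = ∫⁻ a, liminf (fun n => f (u n) a) atTop ∂l := by simp_rw [h1]
    _ ≤ liminf (fun n => ∫⁻ a, f (u n) a ∂l) atTop := lintegral_liminf_le fun n => hf _
    _ ≤ liminf (fun _ : ℕ => c) atTop := liminf_le_liminf (Eventually.of_forall hu)
    _ = c := by simp

/-- A closed set in a proper space is a countable union of compacts, and compacts project to
compacts, so the projection is an F_σ set. -/
lemma measurableSet_image_snd_of_isClosed {X Y : Type*} [PseudoMetricSpace X] [ProperSpace X]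
    [MetricSpace Y] [ProperSpace Y] [MeasurableSpace Y] [BorelSpace Y] {C : Set (X × Y)}
    (hC : IsClosed C) : MeasurableSet (Prod.snd '' C) := by
  rcases C.eq_empty_or_nonempty with rfl | ⟨z, -⟩
  · simp
  have : Prod.snd '' C = ⋃ k : ℕ, Prod.snd '' (C ∩ Metric.closedBall z k) := by
    rw [← image_iUnion, ← inter_iUnion, Metric.iUnion_closedBall_nat, inter_univ]
  rw [this]
  refine MeasurableSet.iUnion fun k => ?_
  exact (((isCompact_closedBall z (k : ℝ)).inter_left hC).image
    continuous_snd).isClosed.measurableSet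

variable {G : Euc d → Euc d} {V₀ : Euc d → ℝ} {xt : Euc d} {ε : ℝ}

lemma posteriorWeight_pos (η x : Euc d) : 0 < posteriorWeight G V₀ xt ε η x := Real.exp_pos _

lemma continuous_posteriorWeight_comp {X : Type*} [TopologicalSpace X] (hG : Continuous G)
    (hV : Continuous V₀) {f g : X → Euc d} (hf : Continuous f) (hg : Continuous g) :
    Continuous fun z => posteriorWeight G V₀ xt ε (f z) (g z) := by
  unfold posteriorWeight data
  fun_prop

lemma posteriorWeight_le (hε : 0 < ε) (η x : Euc d) :
    posteriorWeight G V₀ xt ε η x ≤ Real.exp (-V₀ x) := by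
  refine Real.exp_le_exp.2 ?_
  have : 0 ≤ 1 / (2 * ε) * ‖data G xt ε η - G x‖ ^ 2 := by positivity
  linarith

lemma continuous_posteriorWeight (hG : Continuous G) (hV : Continuous V₀) (η : Euc d) :
    Continuous (posteriorWeight G V₀ xt ε η) :=
  continuous_posteriorWeight_comp hG hV continuous_const continuous_id

lemma integrable_posteriorWeight (hG : Continuous G) (hV : Continuous V₀)
    (hprior : Integrable (fun x => Real.exp (-V₀ x)) volume) (hε : 0 < ε) (η : Euc d) :
    Integrable (posteriorWeight G V₀ xt ε η) :=
  hprior.mono' (continuous_posteriorWeight hG hV η).aestronglyMeasurable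
    (ae_of_all _ fun x => by
      rw [Real.norm_of_nonneg (posteriorWeight_pos η x).le]; exact posteriorWeight_le hε η x)

lemma posteriorZ_pos (hG : Continuous G) (hV : Continuous V₀)
    (hprior : Integrable (fun x => Real.exp (-V₀ x)) volume) (hε : 0 < ε) (η : Euc d) :
    0 < posteriorZ G V₀ xt ε η := by
  unfold posteriorZ
  rw [integral_pos_iff_support_of_nonneg (fun x => (posteriorWeight_pos η x).le)
    (integrable_posteriorWeight hG hV hprior hε η)]
  have : Function.support (posteriorWeight G V₀ xt ε η) = univ := by
    ext x; simp [(posteriorWeight_pos η x).ne']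
  rw [this]
  exact isOpen_univ.measure_pos _ univ_nonempty

lemma continuous_posteriorZ (hG : Continuous G) (hV : Continuous V₀)
    (hprior : Integrable (fun x => Real.exp (-V₀ x)) volume) (hε : 0 < ε) :
    Continuous (posteriorZ G V₀ xt ε) := by
  refine continuous_of_dominated (bound := fun x => Real.exp (-V₀ x))
    (fun η => (continuous_posteriorWeight hG hV η).aestronglyMeasurable)
    (fun η => ae_of_all _ fun x => ?_) hprior (ae_of_all _ fun x => ?_)
  · rw [Real.norm_of_nonneg (posteriorWeight_pos η x).le]
    exact posteriorWeight_le hε η x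
  · exact continuous_posteriorWeight_comp hG hV continuous_id continuous_const

lemma isProbabilityMeasure_posterior (hG : Continuous G) (hV : Continuous V₀)
    (hprior : Integrable (fun x => Real.exp (-V₀ x)) volume) (hε : 0 < ε) (η : Euc d) :
    IsProbabilityMeasure (posterior G V₀ xt ε η) := by
  have hZ := posteriorZ_pos (xt := xt) hG hV hprior hε η
  refine ⟨?_⟩
  rw [posterior, withDensity_apply _ MeasurableSet.univ, Measure.restrict_univ,
    ← ofReal_integral_eq_lintegral_ofReal
      ((integrable_posteriorWeight hG hV hprior hε η).div_const _)
      (ae_of_all _ fun x => div_nonneg (posteriorWeight_pos η x).le hZ.le),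
    integral_div]
  change ENNReal.ofReal (posteriorZ G V₀ xt ε η / _) = 1
  rw [div_self hZ.ne', ENNReal.ofReal_one]

lemma klDiv_map_stdGaussian_posterior (hG : Continuous G) (hV : Continuous V₀)
    (hprior : Integrable (fun x => Real.exp (-V₀ x)) volume) (hε : 0 < ε) (η m : Euc d)
    {B T : Euc d →L[ℝ] Euc d} (h : B * T = 1) :
    klDiv ((stdGaussian (Euc d)).map (fun x => m + T x)) (posterior G V₀ xt ε η) =
      ∫⁻ x, ENNReal.ofReal (posteriorWeight G V₀ xt ε η x / posteriorZ G V₀ xt ε η *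
        klFun (gaussDens m B x /
          (posteriorWeight G V₀ xt ε η x / posteriorZ G V₀ xt ε η))) := by
  have h1 : IsProbabilityMeasure ((stdGaussian (Euc d)).map (fun x => m + T x)) :=
    Measure.isProbabilityMeasure_map (by fun_prop)
  have h2 := isProbabilityMeasure_posterior (xt := xt) hG hV hprior hε η
  have hZ := posteriorZ_pos (xt := xt) hG hV hprior hε η
  rw [map_stdGaussian_eq_withDensity m h] at h1 ⊢
  rw [posterior] at h2 ⊢
  exact klDiv_withDensity_ofReal (measurable_gaussDens m B)
    ((continuous_posteriorWeight hG hV η).measurable.div_const _) (gaussDens_nonneg m B)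
    (fun x => div_pos (posteriorWeight_pos η x) hZ)

lemma exists_right_inverse_of_det_ne_zero {B : Euc d →L[ℝ] Euc d} (h : B.det ≠ 0) :
    ∃ T : Euc d →L[ℝ] Euc d, B * T = 1 := by
  refine ⟨((B.toContinuousLinearEquivOfDetNeZero h).symm : Euc d →L[ℝ] Euc d), ?_⟩
  ext1 x
  exact (B.toContinuousLinearEquivOfDetNeZero h).apply_symm_apply x

lemma isClosed_setOf_lintegral_gaussDens_le (hG : Continuous G) (hV : Continuous V₀)
    (hprior : Integrable (fun x => Real.exp (-V₀ x)) volume) (hε : 0 < ε) (c : ℝ≥0∞) :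
    IsClosed {z : (Euc d × (Euc d →L[ℝ] Euc d)) × Euc d |
      ∫⁻ x, ENNReal.ofReal (posteriorWeight G V₀ xt ε z.2 x / posteriorZ G V₀ xt ε z.2 *
        klFun (gaussDens z.1.1 z.1.2 x /
          (posteriorWeight G V₀ xt ε z.2 x / posteriorZ G V₀ xt ε z.2))) ≤ c} := by
  have hpos : ∀ η x, posteriorWeight G V₀ xt ε η x / posteriorZ G V₀ xt ε η ≠ 0 := fun η x =>
    (div_pos (posteriorWeight_pos η x) (posteriorZ_pos hG hV hprior hε η)).ne'
  have hcont : Continuous fun w : ((Euc d × (Euc d →L[ℝ] Euc d)) × Euc d) × Euc d =>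
      posteriorWeight G V₀ xt ε w.1.2 w.2 / posteriorZ G V₀ xt ε w.1.2 := by
    refine Continuous.div ?_ ?_ fun w => (posteriorZ_pos hG hV hprior hε _).ne'
    · exact continuous_posteriorWeight_comp hG hV (by fun_prop) (by fun_prop)
    · exact (continuous_posteriorZ hG hV hprior hε).comp (by fun_prop)
  have hcont2 : Continuous fun w : ((Euc d × (Euc d →L[ℝ] Euc d)) × Euc d) × Euc d =>
      gaussDens w.1.1.1 w.1.1.2 w.2 :=
    continuous_gaussDens_comp (by fun_prop) (by fun_prop) (by fun_prop)
  have hall : Continuous fun w : ((Euc d × (Euc d →L[ℝ] Euc d)) × Euc d) × Euc d =>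
      ENNReal.ofReal (posteriorWeight G V₀ xt ε w.1.2 w.2 / posteriorZ G V₀ xt ε w.1.2 *
        klFun (gaussDens w.1.1.1 w.1.1.2 w.2 /
          (posteriorWeight G V₀ xt ε w.1.2 w.2 / posteriorZ G V₀ xt ε w.1.2))) :=
    ENNReal.continuous_ofReal.comp (hcont.mul (continuous_klFun.comp
      (hcont2.div hcont fun w => hpos _ _)))
  exact isClosed_setOf_lintegral_le
    (fun z => (hall.comp (by fun_prop : Continuous fun x : Euc d => (z, x))).measurable)
    (fun x => hall.comp (by fun_prop : Continuous
      fun z : (Euc d × (Euc d →L[ℝ] Euc d)) × Euc d => (z, x))) c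

/-- The minimal divergence is a measurable function of the noise. -/
lemma measurable_klDiv_of_isBestGaussian (hG : Continuous G) (hV : Continuous V₀)
    (hprior : Integrable (fun x => Real.exp (-V₀ x)) volume) (hε : 0 < ε)
    {ν : Euc d → Measure (Euc d)} (hν : ∀ η, IsBestGaussian (ν η) (posterior G V₀ xt ε η)) :
    Measurable fun η => klDiv (ν η) (posterior G V₀ xt ε η) := by
  have : ProperSpace (Euc d →L[ℝ] Euc d) := FiniteDimensional.proper ℝ _
  refine measurable_of_Iic fun c => ?_
  rcases eq_or_ne c ⊤ with rfl | hc
  · simp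
  set F : (Euc d × (Euc d →L[ℝ] Euc d)) × Euc d → ℝ≥0∞ := fun z =>
    ∫⁻ x, ENNReal.ofReal (posteriorWeight G V₀ xt ε z.2 x / posteriorZ G V₀ xt ε z.2 *
        klFun (gaussDens z.1.1 z.1.2 x /
          (posteriorWeight G V₀ xt ε z.2 x / posteriorZ G V₀ xt ε z.2))) with hF
  -- The parameter is the inverse B = T⁻¹, in which the density is continuous. At singular B the
  -- density vanishes and the integral is finite although no Gaussian is represented; the closed
  -- cutoff on |det B| excludes this. Since c is finite, degenerate Gaussians do not occur.
  have hset : (fun η => klDiv (ν η) (posterior G V₀ xt ε η)) ⁻¹' Iic c =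
      ⋃ n : ℕ, Prod.snd '' ({z | F z ≤ c} ∩ {z | 1 / ((n : ℝ) + 1) ≤ |z.1.2.det|}) := by
    ext η
    simp only [mem_preimage, mem_Iic, mem_iUnion, mem_image, mem_inter_iff, mem_ofPred_eq]
    constructor
    · intro h
      obtain ⟨m, T, hT⟩ := exists_map_of_mem_gaussianMeasures (hν η).1
      rw [hT] at h
      have hdet : T.det ≠ 0 := by
        intro h0
        have hac := (klDiv_ne_top_iff.1 (ne_top_of_le_ne_top hc h)).1
        exact not_absolutelyContinuous_map_stdGaussian m h0
          (hac.trans (withDensity_absolutelyContinuous _ _))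
      obtain ⟨B, hB⟩ := exists_inverse_of_det_ne_zero hdet
      have hBd : B.det ≠ 0 := left_ne_zero_of_mul_eq_one (det_mul_det_eq_one hB)
      obtain ⟨n, hn⟩ := exists_nat_one_div_lt (abs_pos.2 hBd)
      rw [klDiv_map_stdGaussian_posterior hG hV hprior hε η m hB] at h
      exact ⟨n, ((m, B), η), ⟨h, hn.le⟩, rfl⟩
    · rintro ⟨n, ⟨⟨m, B⟩, η'⟩, ⟨h1, h2⟩, rfl⟩
      have hBd : B.det ≠ 0 := abs_pos.1 (lt_of_lt_of_le (by positivity) h2)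
      obtain ⟨T, hT⟩ := exists_right_inverse_of_det_ne_zero hBd
      refine ((hν η').2 _ (map_stdGaussian_mem_gaussianMeasures m T)).trans ?_
      rw [klDiv_map_stdGaussian_posterior hG hV hprior hε η' m hT]
      exact h1
  rw [hset]
  refine MeasurableSet.iUnion fun n => measurableSet_image_snd_of_isClosed
    ((isClosed_setOf_lintegral_gaussDens_le hG hV hprior hε c).inter ?_)
  have : Continuous fun z : (Euc d × (Euc d →L[ℝ] Euc d)) × Euc d => |z.1.2.det| :=
    (ContinuousLinearMap.continuous_det.comp (by fun_prop)).abs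
  exact isClosed_le continuous_const this

end Measurability

/-! ### Pointwise bounds for the divergence integrand -/

section Scalar

/-- A global second-order bound. The factor e^(-w) is needed for w → -∞, and is affordable because
e^(-W) only exchanges the linearised weight for the exact one. -/
lemma exp_neg_sub_one_add_le (w : ℝ) :
    Real.exp (-w) - 1 + w ≤ w ^ 2 * (1 + Real.exp (-w)) := by
  rcases le_total 0 w with hw | hw
  · have h1 : Real.exp (-w) * (1 + w) ≤ 1 := by
      have := mul_le_mul_of_nonneg_left (Real.add_one_le_exp w) (Real.exp_pos (-w)).le
      rw [← Real.exp_add, neg_add_cancel, Real.exp_zero] at this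
      linarith
    have h2 := Real.exp_pos (-w)
    nlinarith [mul_nonneg hw h2.le, mul_nonneg (sq_nonneg w) h2.le, mul_nonneg hw (sub_nonneg.2 h1)]
  · have h2 := Real.add_one_le_exp w
    have h3 := Real.exp_pos (-w)
    have h5 : 1 = Real.exp (-w) * Real.exp w := by rw [← Real.exp_add]; simp
    nlinarith [mul_nonneg h3.le (mul_nonneg (sub_nonneg.2 h2) (by linarith : (0 : ℝ) ≤ 1 - w)),
      sq_nonneg w]

lemma exists_one_add_pow_le_mul_exp (n : ℕ) {c : ℝ} (hc : 0 < c) :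
    ∃ C : ℝ, 0 < C ∧ ∀ t : ℝ, 0 ≤ t → (1 + t) ^ n ≤ C * Real.exp (c * t) := by
  refine ⟨n.factorial / c ^ n * Real.exp c, by positivity, fun t ht => ?_⟩
  have h := Real.pow_div_factorial_le_exp (c * (1 + t)) (by positivity) n
  rw [mul_pow, mul_add, mul_one, Real.exp_add] at h
  have hn : (0 : ℝ) < n.factorial := by positivity
  rw [div_le_iff₀ hn] at h
  have hcn : 0 < c ^ n := by positivity
  rw [div_mul_eq_mul_div, div_mul_eq_mul_div, le_div_iff₀ hcn]
  linarith

variable {E : Type*} [NormedAddCommGroup E]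

/-- Joint coercivity, from |b| ≤ |a| + |a - b|: the weight decays in η and in the model output
together. -/
lemma sq_norm_add_sq_norm_le (a b : E) :
    (‖a‖ ^ 2 + ‖b‖ ^ 2) / 8 ≤ ‖a‖ ^ 2 / 2 + ‖a - b‖ ^ 2 / 2 := by
  have h : ‖b‖ ≤ ‖a‖ + ‖a - b‖ := by
    have := norm_sub_le a (a - b)
    rwa [sub_sub_cancel] at this
  nlinarith [norm_nonneg a, norm_nonneg b, norm_nonneg (a - b), sq_nonneg (‖a‖ - ‖a - b‖),
    mul_self_le_mul_self (norm_nonneg b) h]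

lemma exp_neg_sq_norm_le {α : ℝ} (hα : 0 ≤ α) {η ζ b : E} (hb : α * ‖ζ‖ ≤ ‖b‖) :
    Real.exp (-(‖η‖ ^ 2 / 2) - ‖η - b‖ ^ 2 / 2) ≤
      Real.exp (-(min 1 (α ^ 2) / 8 * (‖η‖ ^ 2 + ‖ζ‖ ^ 2))) := by
  refine Real.exp_le_exp.2 ?_
  have h1 := sq_norm_add_sq_norm_le η b
  have h2 : (α * ‖ζ‖) ^ 2 ≤ ‖b‖ ^ 2 := pow_le_pow_left₀ (by positivity) hb 2
  have h3 : min 1 (α ^ 2) * ‖η‖ ^ 2 ≤ 1 * ‖η‖ ^ 2 :=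
    mul_le_mul_of_nonneg_right (min_le_left _ _) (by positivity)
  have h4 : min 1 (α ^ 2) * ‖ζ‖ ^ 2 ≤ α ^ 2 * ‖ζ‖ ^ 2 :=
    mul_le_mul_of_nonneg_right (min_le_right _ _) (by positivity)
  rw [mul_pow] at h2
  linarith

/-- The difference of the misfits of a perturbed and an unperturbed model, plus an offset. -/
def misfitGap (η b g : E) (v : ℝ) : ℝ := ‖η - g‖ ^ 2 / 2 - ‖η - b‖ ^ 2 / 2 + v

lemma exp_mul_exp_neg_misfitGap (η b g : E) (v : ℝ) :
    Real.exp (-(‖η‖ ^ 2 / 2) - ‖η - b‖ ^ 2 / 2) * Real.exp (-misfitGap η b g v) =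
      Real.exp (-(‖η‖ ^ 2 / 2) - ‖η - g‖ ^ 2 / 2) * Real.exp (-v) := by
  rw [← Real.exp_add, ← Real.exp_add, misfitGap]
  congr 1
  ring

/-- Difference of squares: one factor is at most |g - b| = O(s|ζ|²), the other grows linearly in |η|
and |ζ|. -/
lemma abs_misfitGap_le {K s : ℝ} (hK : 0 ≤ K) (hs : 0 ≤ s) {η ζ b g : E} {v : ℝ}
    (hbK : ‖b‖ ≤ K * ‖ζ‖) (hgb : ‖g - b‖ ≤ K * (s * ‖ζ‖ ^ 2)) (hv : |v| ≤ K * (s * ‖ζ‖))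
    (hζ : s * ‖ζ‖ ≤ 1) :
    |misfitGap η b g v| ≤ s * ((2 * K + 2 * K ^ 2) * (1 + (‖η‖ ^ 2 + ‖ζ‖ ^ 2)) ^ 2) := by
  set t := ‖η‖ ^ 2 + ‖ζ‖ ^ 2 with ht
  have hη0 := norm_nonneg η
  have hζ0 := norm_nonneg ζ
  have hηt : ‖η‖ ≤ 1 + t := by nlinarith [sq_nonneg (‖η‖ - 1), sq_nonneg ‖ζ‖]
  have hζt : ‖ζ‖ ≤ 1 + t := by nlinarith [sq_nonneg (‖ζ‖ - 1), sq_nonneg ‖η‖]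
  have hζ2 : ‖ζ‖ ^ 2 ≤ 1 + t := by nlinarith [sq_nonneg ‖η‖]
  have ht1 : 1 ≤ 1 + t := by rw [ht]; nlinarith [sq_nonneg ‖η‖, sq_nonneg ‖ζ‖]
  have hgbζ : ‖g - b‖ ≤ K * ‖ζ‖ := by
    refine hgb.trans (mul_le_mul_of_nonneg_left ?_ hK)
    nlinarith
  have hg : ‖g‖ ≤ 2 * K * ‖ζ‖ := by
    have := norm_add_le (g - b) b
    rw [sub_add_cancel] at this
    linarith
  have hsum : ‖η - g‖ + ‖η - b‖ ≤ (2 + 3 * K) * (1 + t) := by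
    have h1 := norm_sub_le η g
    have h2 := norm_sub_le η b
    nlinarith [mul_le_mul_of_nonneg_left hζt hK]
  have hdiff : |‖η - g‖ - ‖η - b‖| ≤ ‖g - b‖ := by
    refine (abs_norm_sub_norm_le _ _).trans ?_
    rw [sub_sub_sub_cancel_left, norm_sub_rev]
  have hfac : misfitGap η b g v =
      (‖η - g‖ - ‖η - b‖) * (‖η - g‖ + ‖η - b‖) / 2 + v := by
    unfold misfitGap; ring
  have h0 : 0 ≤ ‖η - g‖ + ‖η - b‖ := by positivity
  calc |misfitGap η b g v|
      ≤ |‖η - g‖ - ‖η - b‖| * (‖η - g‖ + ‖η - b‖) / 2 + |v| := by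
        rw [hfac]
        refine (abs_add_le _ _).trans (le_of_eq ?_)
        rw [abs_div, abs_mul, abs_of_nonneg h0, abs_two]
    _ ≤ (K * (s * (1 + t))) * ((2 + 3 * K) * (1 + t)) / 2 + K * (s * (1 + t)) := by
        have e1 : |‖η - g‖ - ‖η - b‖| ≤ K * (s * (1 + t)) :=
          (hdiff.trans hgb).trans (by gcongr)
        have e2 : |v| ≤ K * (s * (1 + t)) := hv.trans (by gcongr)
        gcongr
    _ ≤ s * ((2 * K + 2 * K ^ 2) * (1 + t) ^ 2) := by
        have h2 : (1 + t) ≤ (1 + t) ^ 2 := by nlinarith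
        have h3 : 0 ≤ K * s := by positivity
        nlinarith [mul_le_mul_of_nonneg_left h2 h3,
          mul_nonneg (mul_nonneg h3 hK) (sq_nonneg (1 + t))]

/-- Gaussian bound for the divergence integrand where the linearisation is accurate. -/
lemma exists_near_bound {α K : ℝ} (hα : 0 < α) (hK : 0 ≤ K) :
    ∃ C : ℝ, 0 < C ∧ ∀ (s : ℝ) (η ζ b g : E) (v : ℝ), 0 ≤ s → s * ‖ζ‖ ≤ 1 →
      α * ‖ζ‖ ≤ ‖b‖ → α * ‖ζ‖ ≤ ‖g‖ → ‖b‖ ≤ K * ‖ζ‖ →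
      ‖g - b‖ ≤ K * (s * ‖ζ‖ ^ 2) → |v| ≤ K * (s * ‖ζ‖) →
      Real.exp (-(‖η‖ ^ 2 / 2) - ‖η - b‖ ^ 2 / 2) *
          (Real.exp (-misfitGap η b g v) - 1 + misfitGap η b g v) ≤
        C * s ^ 2 * Real.exp (-(min 1 (α ^ 2) / 16 * (‖η‖ ^ 2 + ‖ζ‖ ^ 2))) := by
  obtain ⟨C₄, hC₄, h4⟩ := exists_one_add_pow_le_mul_exp 4
    (by positivity : (0 : ℝ) < min 1 (α ^ 2) / 16)
  refine ⟨((2 * K + 2 * K ^ 2) ^ 2 + 1) * (1 + Real.exp K) * C₄, by positivity, ?_⟩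
  intro s η ζ b g v hs hζ hb hg hbK hgb hv
  set c := min 1 (α ^ 2) / 16 with hc
  -- The weight decays at rate 2c; half of it is spent on absorbing the polynomial.
  have hc2 : min 1 (α ^ 2) / 8 = 2 * c := by rw [hc]; ring
  set t := ‖η‖ ^ 2 + ‖ζ‖ ^ 2 with ht
  have ht0 : 0 ≤ t := by positivity
  set W := misfitGap η b g v with hW
  set P := Real.exp (-(‖η‖ ^ 2 / 2) - ‖η - b‖ ^ 2 / 2) with hP
  have hP0 : 0 ≤ P := (Real.exp_pos _).le
  have hW1 := abs_misfitGap_le (η := η) hK hs hbK hgb hv hζ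
  have hW2 : W ^ 2 ≤ s ^ 2 * ((2 * K + 2 * K ^ 2) ^ 2 * (1 + t) ^ 4) := by
    rw [← sq_abs]
    refine (pow_le_pow_left₀ (abs_nonneg _) hW1 2).trans (le_of_eq ?_)
    ring
  have hPb : P ≤ Real.exp (-(2 * c * t)) := by
    have := exp_neg_sq_norm_le (η := η) hα.le hb
    rwa [hc2] at this
  have hPg : P * Real.exp (-W) ≤ Real.exp K * Real.exp (-(2 * c * t)) := by
    rw [hP, hW, exp_mul_exp_neg_misfitGap, mul_comm]
    have h1 := exp_neg_sq_norm_le (η := η) hα.le hg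
    rw [hc2] at h1
    have h2 : -v ≤ K := by
      have := (abs_le.1 hv).1
      nlinarith
    exact mul_le_mul (Real.exp_le_exp.2 h2) h1 (Real.exp_pos _).le (Real.exp_pos _).le
  have hsum : P * (1 + Real.exp (-W)) ≤ (1 + Real.exp K) * Real.exp (-(2 * c * t)) := by
    linarith
  have hexp : (1 + t) ^ 4 * Real.exp (-(2 * c * t)) ≤ C₄ * Real.exp (-(c * t)) := by
    refine (mul_le_mul_of_nonneg_right (h4 t ht0) (Real.exp_pos _).le).trans (le_of_eq ?_)
    rw [mul_assoc, ← Real.exp_add]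
    congr 2
    ring
  calc P * (Real.exp (-W) - 1 + W) ≤ P * (W ^ 2 * (1 + Real.exp (-W))) :=
        mul_le_mul_of_nonneg_left (exp_neg_sub_one_add_le W) hP0
    _ = W ^ 2 * (P * (1 + Real.exp (-W))) := by ring
    _ ≤ (s ^ 2 * ((2 * K + 2 * K ^ 2) ^ 2 * (1 + t) ^ 4)) *
        ((1 + Real.exp K) * Real.exp (-(2 * c * t))) :=
        mul_le_mul hW2 hsum (by positivity) (by positivity)
    _ = s ^ 2 * (2 * K + 2 * K ^ 2) ^ 2 * (1 + Real.exp K) *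
        ((1 + t) ^ 4 * Real.exp (-(2 * c * t))) := by ring
    _ ≤ s ^ 2 * ((2 * K + 2 * K ^ 2) ^ 2 + 1) * (1 + Real.exp K) *
        (C₄ * Real.exp (-(c * t))) := by
        gcongr
        linarith
    _ = _ := by ring

/-- Bound for the divergence integrand away from the truth. -/
lemma exists_far_bound {α K δ κ : ℝ} (hα : 0 < α) (hK : 0 ≤ K) (hδ : 0 < δ) :
    ∃ C : ℝ, 0 < C ∧ ∀ (s : ℝ) (η ζ b g : E) (v : ℝ), 0 < s → s ≤ 1 →
      s ^ 2 ≤ min 1 (α ^ 2) / 64 → δ ≤ s * ‖ζ‖ → α * ‖ζ‖ ≤ ‖b‖ →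
      κ ≤ s ^ 2 * ‖g‖ ^ 2 → s ^ 2 * ‖g‖ ^ 2 ≤ K * Real.exp (2 * s ^ 2 * ‖ζ‖ ^ 2) →
      |v| ≤ K * Real.exp (2 * s ^ 2 * ‖ζ‖ ^ 2) →
      Real.exp (-(‖η‖ ^ 2 / 2) - ‖η - b‖ ^ 2 / 2) *
          (Real.exp (-misfitGap η b g v) - 1 + misfitGap η b g v) ≤
        C * s ^ 2 * Real.exp (-(min 1 (α ^ 2) / 16 * (‖η‖ ^ 2 + ‖ζ‖ ^ 2))) +
          Real.exp (-(κ / 8 / s ^ 2)) * (Real.exp (-(1 / 8) * ‖η‖ ^ 2) * Real.exp (-v)) := by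
  obtain ⟨C₃, hC₃, h3⟩ := exists_one_add_pow_le_mul_exp 3
    (by positivity : (0 : ℝ) < min 1 (α ^ 2) / 32)
  refine ⟨(1 + 2 * K) / δ ^ 4 * C₃, by positivity, ?_⟩
  intro s η ζ b g v hs hs1 hsc hζ hb hκ hg hv
  set c := min 1 (α ^ 2) / 16 with hc
  have hc2 : min 1 (α ^ 2) / 8 = 2 * c := by rw [hc]; ring
  have hc3 : min 1 (α ^ 2) / 32 = c / 2 := by rw [hc]; ring
  have hc4 : min 1 (α ^ 2) / 64 = c / 4 := by rw [hc]; ring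
  rw [hc3] at h3
  rw [hc4] at hsc
  set t := ‖η‖ ^ 2 + ‖ζ‖ ^ 2 with ht
  have ht0 : 0 ≤ t := by positivity
  set W := misfitGap η b g v with hW
  set P := Real.exp (-(‖η‖ ^ 2 / 2) - ‖η - b‖ ^ 2 / 2) with hP
  have hP0 : 0 ≤ P := (Real.exp_pos _).le
  have hs2 : 0 < s ^ 2 := by positivity
  set X := Real.exp (2 * s ^ 2 * ‖ζ‖ ^ 2) with hX
  have hX1 : 1 ≤ X := Real.one_le_exp (by positivity)
  -- This is where s must be small: s² ≤ c/4 makes the growth cost only c/2 of the decay rate.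
  have hXc : X ≤ Real.exp (c / 2 * t) := by
    refine Real.exp_le_exp.2 ?_
    rw [ht]
    nlinarith [sq_nonneg ‖η‖, sq_nonneg ‖ζ‖, mul_le_mul_of_nonneg_right hsc (sq_nonneg ‖ζ‖),
      mul_nonneg (hs2.le.trans hsc) (sq_nonneg ‖η‖)]
  have hPb : P ≤ Real.exp (-(2 * c * t)) := by
    have := exp_neg_sq_norm_le (η := η) hα.le hb
    rwa [hc2] at this
  have hPg : P * Real.exp (-W) ≤
      Real.exp (-(κ / 8 / s ^ 2)) * (Real.exp (-(1 / 8) * ‖η‖ ^ 2) * Real.exp (-v)) := by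
    rw [hP, hW, exp_mul_exp_neg_misfitGap, ← mul_assoc]
    refine mul_le_mul_of_nonneg_right ?_ (Real.exp_pos _).le
    rw [← Real.exp_add, Real.exp_le_exp]
    have h1 := sq_norm_add_sq_norm_le η g
    have h2 : κ / 8 / s ^ 2 ≤ ‖g‖ ^ 2 / 8 := by
      rw [div_le_iff₀ hs2]
      linarith
    linarith
  -- Since s|ζ| ≥ δ, powers of s can be bought with powers of t. The s⁴ pays for the s⁻² in the
  -- bound on W and leaves s².
  have hone : 1 ≤ s ^ 4 * (1 + t) ^ 2 / δ ^ 4 := by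
    rw [one_le_div (by positivity)]
    calc δ ^ 4 ≤ (s * ‖ζ‖) ^ 4 := pow_le_pow_left₀ hδ.le hζ 4
      _ = s ^ 4 * (‖ζ‖ ^ 2) ^ 2 := by ring
      _ ≤ s ^ 4 * (1 + t) ^ 2 := by
        gcongr
        rw [ht]
        nlinarith [sq_nonneg ‖η‖]
  have hWle : W ≤ (1 + 2 * K) * (1 + t) * X / s ^ 2 := by
    have e1 : ‖η - g‖ ^ 2 / 2 ≤ ‖η‖ ^ 2 + ‖g‖ ^ 2 := by
      have := pow_le_pow_left₀ (norm_nonneg _) (norm_sub_le η g) 2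
      linarith [add_sq_le (a := ‖η‖) (b := ‖g‖)]
    have e2 : W ≤ ‖η‖ ^ 2 + ‖g‖ ^ 2 + |v| := by
      rw [hW, misfitGap]
      linarith [sq_nonneg ‖η - b‖, le_abs_self v]
    rw [le_div_iff₀ hs2]
    have e3 : ‖η‖ ^ 2 ≤ t := le_add_of_nonneg_right (sq_nonneg _)
    have hs21 : s ^ 2 ≤ 1 := pow_le_one₀ hs.le hs1
    have hKX : 0 ≤ K * X := by positivity
    calc W * s ^ 2 ≤ (‖η‖ ^ 2 + ‖g‖ ^ 2 + |v|) * s ^ 2 := by gcongr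
      _ = s ^ 2 * ‖η‖ ^ 2 + s ^ 2 * ‖g‖ ^ 2 + s ^ 2 * |v| := by ring
      _ ≤ 1 * t + K * X + 1 * (K * X) := by gcongr
      _ ≤ (1 + 2 * K) * (1 + t) * X := by
        linarith [mul_nonneg hKX ht0, mul_nonneg ht0 (sub_nonneg.2 hX1)]
  have hPW : P * W ≤ (1 + 2 * K) / δ ^ 4 * C₃ * s ^ 2 * Real.exp (-(c * t)) := by
    have hU : 0 ≤ (1 + 2 * K) * (1 + t) * X / s ^ 2 := by positivity
    calc P * W ≤ P * ((1 + 2 * K) * (1 + t) * X / s ^ 2) := mul_le_mul_of_nonneg_left hWle hP0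
      _ ≤ Real.exp (-(2 * c * t)) * ((1 + 2 * K) * (1 + t) * X / s ^ 2) :=
        mul_le_mul_of_nonneg_right hPb hU
      _ ≤ Real.exp (-(2 * c * t)) * ((1 + 2 * K) * (1 + t) * Real.exp (c / 2 * t) / s ^ 2) *
          (s ^ 4 * (1 + t) ^ 2 / δ ^ 4) := by
        refine le_trans ?_ (le_mul_of_one_le_right (by positivity) hone)
        gcongr
      _ = (1 + 2 * K) / δ ^ 4 * s ^ 2 *
          ((1 + t) ^ 3 * (Real.exp (c / 2 * t) * Real.exp (-(2 * c * t)))) := by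
        field_simp
      _ ≤ (1 + 2 * K) / δ ^ 4 * s ^ 2 *
          ((C₃ * Real.exp (c / 2 * t)) * (Real.exp (c / 2 * t) * Real.exp (-(2 * c * t)))) := by
        have := h3 t ht0
        gcongr
      _ = (1 + 2 * K) / δ ^ 4 * C₃ * s ^ 2 * Real.exp (-(c * t)) := by
        have : Real.exp (-(c * t)) =
            Real.exp (c / 2 * t) * (Real.exp (c / 2 * t) * Real.exp (-(2 * c * t))) := by
          rw [← Real.exp_add, ← Real.exp_add]
          congr 1
          ring
        rw [this]
        ring
  have : P * (Real.exp (-W) - 1 + W) ≤ P * W + P * Real.exp (-W) := by linarith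
  linarith

end Scalar

/-! ### Local expansion at the truth and global separation from it -/

section Local

variable {G : Euc d → Euc d} {V₀ : Euc d → ℝ} {xt : Euc d}

lemma exists_inverse_fderiv
    (h : IsLocalDiffeomorphAt 𝓘(ℝ, Euc d) 𝓘(ℝ, Euc d) 1 G xt) :
    ∃ A' : Euc d →L[ℝ] Euc d, fderiv ℝ G xt * A' = 1 ∧ A' * fderiv ℝ G xt = 1 := by
  let e : Euc d ≃L[ℝ] Euc d := h.mfderivToContinuousLinearEquiv one_ne_zero
  have he : ∀ v, (e v : Euc d) = fderiv ℝ G xt v := fun v => by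
    have h1 : (e v : Euc d) = mfderiv 𝓘(ℝ, Euc d) 𝓘(ℝ, Euc d) G xt v := rfl
    rw [h1, mfderiv_eq_fderiv]
    rfl
  refine ⟨(e.symm : Euc d →L[ℝ] Euc d), ?_, ?_⟩
  · ext1 v
    exact (he (e.symm v)).symm.trans (e.apply_symm_apply v)
  · ext1 v
    change e.symm (fderiv ℝ G xt v) = v
    rw [← he]
    exact e.symm_apply_apply v

/-- Both DG and V₀ are locally Lipschitz; the mean value inequality on the ball of radius |x - x†|
gives the quadratic remainder. -/
lemma exists_local_taylor_bound (hG : ContDiff ℝ 2 G) (hV : ContDiff ℝ 1 V₀) (xt : Euc d) :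
    ∃ δ K : ℝ, 0 < δ ∧ 0 < K ∧ ∀ x, ‖x - xt‖ ≤ δ →
      ‖G x - G xt - fderiv ℝ G xt (x - xt)‖ ≤ K * ‖x - xt‖ ^ 2 ∧
      |V₀ x - V₀ xt| ≤ K * ‖x - xt‖ := by
  have hG' : ContDiff ℝ 1 (fderiv ℝ G) := hG.fderiv_right (by norm_num)
  obtain ⟨K₁, s₁, hs₁, hl₁⟩ := hG'.contDiffAt (x := xt).exists_lipschitzOnWith
  obtain ⟨K₂, s₂, hs₂, hl₂⟩ := hV.contDiffAt (x := xt).exists_lipschitzOnWith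
  obtain ⟨δ, hδ, hball⟩ := Metric.nhds_basis_closedBall.mem_iff.1 (Filter.inter_mem hs₁ hs₂)
  refine ⟨δ, K₁ + K₂ + 1, hδ, by positivity, fun x hx => ⟨?_, ?_⟩⟩
  · have hsub : ∀ y ∈ Metric.closedBall xt ‖x - xt‖, ‖y - xt‖ ≤ ‖x - xt‖ ∧ y ∈ s₁ := fun y hy =>
      have := mem_closedBall_iff_norm.1 hy
      ⟨this, (hball (mem_closedBall_iff_norm.2 (this.trans hx))).1⟩
    have hd : Differentiable ℝ G := hG.differentiable (by norm_num)
    have := (convex_closedBall xt ‖x - xt‖).norm_image_sub_le_of_norm_hasFDerivWithin_le'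
      (f := G) (f' := fderiv ℝ G) (φ := fderiv ℝ G xt) (C := K₁ * ‖x - xt‖)
      (x := xt) (y := x) (fun y _ => (hd y).hasFDerivAt.hasFDerivWithinAt)
      (fun y hy => by
        have h1 := hl₁.norm_sub_le (hsub y hy).2 (mem_of_mem_nhds hs₁)
        exact h1.trans (mul_le_mul_of_nonneg_left (hsub y hy).1 K₁.2))
      (Metric.mem_closedBall_self (norm_nonneg _)) (mem_closedBall_iff_norm.2 le_rfl)
    refine this.trans ?_
    nlinarith [sq_nonneg ‖x - xt‖, K₂.2, mul_nonneg K₂.2 (sq_nonneg ‖x - xt‖)]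
  · have h1 := hl₂.norm_sub_le (hball (mem_closedBall_iff_norm.2 hx)).2 (mem_of_mem_nhds hs₂)
    rw [Real.norm_eq_abs] at h1
    refine h1.trans (mul_le_mul_of_nonneg_right ?_ (norm_nonneg _))
    linarith [K₁.2]

/-- Coercivity handles large |x|; on the remaining compact set the minimum is positive by
injectivity at x†. -/
lemma exists_pos_le_sq_norm_sub (hG : Continuous G) (hGinj : ∀ x, G x = G xt → x = xt)
    (hcoercive : ∃ c₀ c₁ : ℝ, 0 < c₀ ∧ 0 < c₁ ∧ ∀ x,
      -c₀ + c₁ * ‖x‖ ^ 2 ≤ (1 / 2) * ‖G xt - G x‖ ^ 2) {δ : ℝ} (hδ : 0 < δ) :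
    ∃ κ : ℝ, 0 < κ ∧ ∀ x, δ ≤ ‖x - xt‖ → κ ≤ ‖G x - G xt‖ ^ 2 := by
  obtain ⟨c₀, c₁, h0, h1, hc⟩ := hcoercive
  set R := Real.sqrt ((1 + c₀) / c₁) with hR
  have hR2 : R ^ 2 = (1 + c₀) / c₁ := Real.sq_sqrt (by positivity)
  have hfar : ∀ x, R ≤ ‖x‖ → 1 ≤ ‖G x - G xt‖ ^ 2 := fun x hx => by
    have h2 : R ^ 2 ≤ ‖x‖ ^ 2 := pow_le_pow_left₀ (Real.sqrt_nonneg _) hx 2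
    rw [hR2, div_le_iff₀ h1] at h2
    have h3 := hc x
    rw [norm_sub_rev] at h3
    linarith
  have hcomp : IsCompact (Metric.closedBall (0 : Euc d) R ∩ {x | δ ≤ ‖x - xt‖}) :=
    (isCompact_closedBall _ _).inter_right (isClosed_le continuous_const (by fun_prop))
  rcases (Metric.closedBall (0 : Euc d) R ∩ {x | δ ≤ ‖x - xt‖}).eq_empty_or_nonempty with he | hne
  · refine ⟨1, one_pos, fun x hx => hfar x ?_⟩
    by_contra! hlt
    have : x ∈ (∅ : Set (Euc d)) := he ▸ ⟨by simpa using hlt.le, hx⟩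
    exact this
  · obtain ⟨x₀, hx₀, hmin⟩ := hcomp.exists_isMinOn hne
      (f := fun x => ‖G x - G xt‖ ^ 2) (by fun_prop)
    have hpos : 0 < ‖G x₀ - G xt‖ ^ 2 := by
      have : G x₀ - G xt ≠ 0 := fun h => by
        have := hGinj x₀ (sub_eq_zero.1 h)
        have h2 : δ ≤ ‖x₀ - xt‖ := hx₀.2
        rw [this, sub_self, norm_zero] at h2
        linarith
      positivity
    refine ⟨min 1 (‖G x₀ - G xt‖ ^ 2), lt_min one_pos hpos, fun x hx => ?_⟩
    rcases le_total R ‖x‖ with h | h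
    · exact (min_le_left _ _).trans (hfar x h)
    · exact (min_le_right _ _).trans (hmin ⟨by simpa using h, hx⟩)

end Local

/-! ### The linearised competitor and the averaged estimate -/

section Main

variable {G : Euc d → Euc d} {V₀ : Euc d → ℝ} {xt : Euc d}

/-- The integrand of the divergence between the linearised and the exact posterior. -/
def divIntegrand (G : Euc d → Euc d) (V₀ : Euc d → ℝ) (xt : Euc d) (s : ℝ) (η x : Euc d) : ℝ :=
  Real.exp (-(‖η‖ ^ 2 / 2) - ‖η - s⁻¹ • fderiv ℝ G xt (x - xt)‖ ^ 2 / 2) *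
    (Real.exp (-misfitGap η (s⁻¹ • fderiv ℝ G xt (x - xt)) (s⁻¹ • (G x - G xt))
        (V₀ x - V₀ xt)) - 1 +
      misfitGap η (s⁻¹ • fderiv ℝ G xt (x - xt)) (s⁻¹ • (G x - G xt)) (V₀ x - V₀ xt))

lemma exists_divIntegrand_le (hG : ContDiff ℝ 2 G) (hGinj : ∀ x, G x = G xt → x = xt)
    {A' : Euc d →L[ℝ] Euc d} (hA' : A' * fderiv ℝ G xt = 1) (hV : ContDiff ℝ 1 V₀)
    (hgrowth : ∃ M : ℝ, 0 < M ∧ ∀ x,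
      (1 / 2) * ‖G xt - G x‖ ^ 2 ≤ M * Real.exp (‖x‖ ^ 2) ∧
      |V₀ x| ≤ M * Real.exp (‖x‖ ^ 2))
    (hcoercive : ∃ c₀ c₁ : ℝ, 0 < c₀ ∧ 0 < c₁ ∧ ∀ x,
      -c₀ + c₁ * ‖x‖ ^ 2 ≤ (1 / 2) * ‖G xt - G x‖ ^ 2) :
    ∃ C c κ s₀ : ℝ, 0 < C ∧ 0 < c ∧ 0 < κ ∧ 0 < s₀ ∧ s₀ ≤ 1 ∧ ∀ s, 0 < s → s < s₀ → ∀ η x,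
      divIntegrand G V₀ xt s η x ≤
        C * s ^ 2 * (Real.exp (-c * ‖η‖ ^ 2) * Real.exp (-(c / s ^ 2) * ‖x - xt‖ ^ 2)) +
        C * Real.exp (-(κ / s ^ 2)) * (Real.exp (-(1 / 8) * ‖η‖ ^ 2) * Real.exp (-V₀ x)) := by
  set A := fderiv ℝ G xt with hA
  -- Half of a lower bound for A, so that g keeps the bound α|ζ| after the Taylor remainder is
  -- subtracted.
  set α : ℝ := 1 / (2 * (‖A'‖ + 1)) with hαdef
  have hα : 0 < α := by positivity
  have hlow : ∀ r, 2 * α * ‖r‖ ≤ ‖A r‖ := fun r => by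
    have h1 : A' (A r) = r := congrArg (fun L : Euc d →L[ℝ] Euc d => L r) hA'
    have h2 := A'.le_opNorm (A r)
    rw [h1] at h2
    have h3 : 2 * α * (‖A'‖ + 1) = 1 := by rw [hαdef]; field_simp
    have h4 : ‖r‖ ≤ (‖A'‖ + 1) * ‖A r‖ := by nlinarith [norm_nonneg (A r)]
    calc 2 * α * ‖r‖ ≤ 2 * α * ((‖A'‖ + 1) * ‖A r‖) := by gcongr
      _ = ‖A r‖ := by rw [← mul_assoc, h3, one_mul]
  obtain ⟨δ₁, K₁, hδ₁, hK₁, htaylor⟩ := exists_local_taylor_bound hG hV xt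
  -- Within δ the expansion holds, s|ζ| ≤ 1, and the remainder is at most α|x - x†|.
  set δ := min δ₁ (min 1 (α / K₁)) with hδdef
  have hδ : 0 < δ := lt_min hδ₁ (lt_min one_pos (by positivity))
  obtain ⟨κ, hκ, hsep⟩ := exists_pos_le_sq_norm_sub hG.continuous hGinj hcoercive hδ
  obtain ⟨M, hM, hMx⟩ := hgrowth
  -- From |x|² ≤ 2|x†|² + 2|x - x†|²; the factor 2 clears the 1/2 in the misfit and covers both
  -- values of V₀.
  set K₂ := 2 * M * Real.exp (2 * ‖xt‖ ^ 2) with hK₂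
  obtain ⟨C₁, hC₁, hnear⟩ := exists_near_bound (E := Euc d) hα
    (by positivity : 0 ≤ K₁ + ‖A‖)
  obtain ⟨C₂, hC₂, hfar⟩ := exists_far_bound (E := Euc d) (κ := κ) hα
    (by positivity : 0 ≤ K₂) hδ
  set c := min 1 (α ^ 2) / 16 with hc
  have hc0 : 0 < c := by positivity
  refine ⟨C₁ + C₂ + Real.exp (V₀ xt), c, κ / 8, min 1 (c / 4), by positivity, hc0,
    by positivity, by positivity, min_le_left _ _, ?_⟩
  intro s hs hss η x
  have hs1 : s ≤ 1 := (hss.le.trans (min_le_left _ _))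
  have hsc : s ^ 2 ≤ min 1 (α ^ 2) / 64 := by
    have h1 : s ≤ c / 4 := hss.le.trans (min_le_right _ _)
    have h2 : s ^ 2 ≤ s := by nlinarith
    refine (h2.trans h1).trans (le_of_eq ?_)
    rw [hc]; ring
  set r := x - xt with hr
  have hnorm : ∀ w : Euc d, ‖s⁻¹ • w‖ = s⁻¹ * ‖w‖ := fun w => by
    rw [norm_smul, Real.norm_of_nonneg (inv_nonneg.2 hs.le)]
  have hsζ : s * ‖s⁻¹ • r‖ = ‖r‖ := by rw [hnorm, mul_inv_cancel_left₀ hs.ne']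
  have hsζ2 : s * ‖s⁻¹ • r‖ ^ 2 = s⁻¹ * ‖r‖ ^ 2 := by
    rw [hnorm]; field_simp
  have hb : 2 * α * ‖s⁻¹ • r‖ ≤ ‖s⁻¹ • A r‖ := by
    rw [hnorm, hnorm]
    have := mul_le_mul_of_nonneg_left (hlow r) (inv_nonneg.2 hs.le)
    linarith
  have hb' : α * ‖s⁻¹ • r‖ ≤ ‖s⁻¹ • A r‖ := by
    have : 0 ≤ α * ‖s⁻¹ • r‖ := by positivity
    linarith
  have hEq : Real.exp (-(c * (‖η‖ ^ 2 + ‖s⁻¹ • r‖ ^ 2))) =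
      Real.exp (-c * ‖η‖ ^ 2) * Real.exp (-(c / s ^ 2) * ‖r‖ ^ 2) := by
    rw [← Real.exp_add, hnorm]
    congr 1
    field_simp
    ring
  have hpos1 : 0 ≤ s ^ 2 * (Real.exp (-c * ‖η‖ ^ 2) * Real.exp (-(c / s ^ 2) * ‖r‖ ^ 2)) := by
    positivity
  have hpos2 : 0 ≤ Real.exp (-(κ / 8 / s ^ 2)) *
      (Real.exp (-(1 / 8) * ‖η‖ ^ 2) * Real.exp (-V₀ x)) := by positivity
  unfold divIntegrand
  rw [← hA]
  rcases le_total ‖r‖ δ with hrδ | hrδ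
  · obtain ⟨hT, hVl⟩ := htaylor x (hrδ.trans (min_le_left _ _))
    have hr1 : ‖r‖ ≤ 1 := hrδ.trans ((min_le_right _ _).trans (min_le_left _ _))
    have hrα : K₁ * ‖r‖ ≤ α := by
      have := hrδ.trans ((min_le_right _ _).trans (min_le_right _ _))
      rwa [le_div_iff₀ hK₁, mul_comm] at this
    have hgb : ‖s⁻¹ • (G x - G xt) - s⁻¹ • A r‖ ≤ K₁ * (s * ‖s⁻¹ • r‖ ^ 2) := by
      rw [← smul_sub, hnorm, hsζ2]
      have := mul_le_mul_of_nonneg_left hT (inv_nonneg.2 hs.le)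
      linarith
    have hg : α * ‖s⁻¹ • r‖ ≤ ‖s⁻¹ • (G x - G xt)‖ := by
      have h1 : ‖s⁻¹ • A r‖ - ‖s⁻¹ • (G x - G xt)‖ ≤ K₁ * (s * ‖s⁻¹ • r‖ ^ 2) := by
        refine (norm_sub_norm_le _ _).trans ?_
        rwa [norm_sub_rev]
      have h2 : K₁ * (s * ‖s⁻¹ • r‖ ^ 2) ≤ α * ‖s⁻¹ • r‖ := by
        have : K₁ * (s * ‖s⁻¹ • r‖ ^ 2) = K₁ * ‖r‖ * ‖s⁻¹ • r‖ := by
          rw [← hsζ]; ring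
        rw [this]
        gcongr
      linarith
    have := hnear s η (s⁻¹ • r) (s⁻¹ • A r) (s⁻¹ • (G x - G xt)) (V₀ x - V₀ xt) hs.le
      (hsζ.trans_le hr1) hb' hg
      (by
        rw [hnorm, hnorm]
        have h1 := mul_le_mul_of_nonneg_left (A.le_opNorm r) (inv_nonneg.2 hs.le)
        have h2 : 0 ≤ K₁ * (s⁻¹ * ‖r‖) := by positivity
        linarith)
      (hgb.trans (by gcongr; linarith [norm_nonneg A]))
      (by
        rw [hsζ]
        exact hVl.trans (by gcongr; linarith [norm_nonneg A]))
    rw [hEq] at this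
    linarith [mul_nonneg hC₂.le hpos1, mul_nonneg (Real.exp_pos (V₀ xt)).le hpos1,
      mul_nonneg (add_pos (add_pos hC₁ hC₂) (Real.exp_pos (V₀ xt))).le hpos2]
  · have hexp : 2 * s ^ 2 * ‖s⁻¹ • r‖ ^ 2 = 2 * ‖r‖ ^ 2 := by
      rw [← hsζ]; ring
    have hxle : Real.exp (‖x‖ ^ 2) ≤ Real.exp (2 * ‖xt‖ ^ 2) * Real.exp (2 * ‖r‖ ^ 2) := by
      rw [← Real.exp_add, Real.exp_le_exp]
      have h1 : ‖x‖ ≤ ‖xt‖ + ‖r‖ := by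
        have := norm_add_le xt r
        rwa [hr, add_sub_cancel] at this
      have h2 := pow_le_pow_left₀ (norm_nonneg x) h1 2
      linarith [add_sq_le (a := ‖xt‖) (b := ‖r‖)]
    have hxtle : Real.exp (‖xt‖ ^ 2) ≤ Real.exp (2 * ‖xt‖ ^ 2) * Real.exp (2 * ‖r‖ ^ 2) := by
      rw [← Real.exp_add, Real.exp_le_exp]
      linarith [sq_nonneg ‖xt‖, sq_nonneg ‖r‖]
    have hsg : s ^ 2 * ‖s⁻¹ • (G x - G xt)‖ ^ 2 = ‖G x - G xt‖ ^ 2 := by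
      rw [hnorm]; field_simp
    have := hfar s η (s⁻¹ • r) (s⁻¹ • A r) (s⁻¹ • (G x - G xt)) (V₀ x - V₀ xt) hs hs1 hsc
      (hsζ.symm ▸ hrδ) hb' (by rw [hsg]; exact hsep x hrδ)
      (by
        rw [hsg, hexp, norm_sub_rev, hK₂]
        have h1 := (hMx x).1
        have h2 := mul_le_mul_of_nonneg_left hxle hM.le
        linarith)
      (by
        rw [hexp, hK₂]
        have h1 := abs_sub (V₀ x) (V₀ xt)
        have h2 := mul_le_mul_of_nonneg_left hxle hM.le
        have h3 := mul_le_mul_of_nonneg_left hxtle hM.le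
        have h4 := (hMx x).2
        have h5 := (hMx xt).2
        linarith)
    rw [hEq] at this
    have hv : Real.exp (-(V₀ x - V₀ xt)) = Real.exp (V₀ xt) * Real.exp (-V₀ x) := by
      rw [← Real.exp_add]; congr 1; ring
    rw [hv] at this
    linarith [mul_nonneg hC₁.le hpos1, mul_nonneg (Real.exp_pos (V₀ xt)).le hpos1,
      mul_nonneg hC₁.le hpos2, mul_nonneg hC₂.le hpos2]

/-- The divergence of the Gaussian obtained by linearising the forward map at the truth. -/
lemma klDiv_linearised_le (hG : Continuous G) (hV : Continuous V₀)
    (hprior : Integrable (fun x => Real.exp (-V₀ x)) volume)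
    {A' : Euc d →L[ℝ] Euc d} (hA' : fderiv ℝ G xt * A' = 1) {ε : ℝ} (hε : 0 < ε) (η : Euc d) :
    klDiv ((stdGaussian (Euc d)).map
        (fun x => (xt + Real.sqrt ε • A' η) + (Real.sqrt ε • A') x))
        (posterior G V₀ xt ε η) ≤
      ∫⁻ x, ENNReal.ofReal (|((Real.sqrt ε)⁻¹ • fderiv ℝ G xt).det| * stdConst d *
        Real.exp (‖η‖ ^ 2 / 2) * divIntegrand G V₀ xt (Real.sqrt ε) η x) := by
  set s := Real.sqrt ε with hs
  have hs0 : 0 < s := Real.sqrt_pos.2 hε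
  have hs2 : s ^ 2 = ε := Real.sq_sqrt hε.le
  set A := fderiv ℝ G xt with hA
  set m := xt + s • A' η with hm
  have hBT : (s⁻¹ • A) * (s • A') = 1 := by
    ext1 x
    have hx : A (A' x) = x := congrArg (fun L : Euc d →L[ℝ] Euc d => L x) hA'
    change s⁻¹ • A (s • A' x) = x
    rw [map_smul, smul_smul, inv_mul_cancel₀ hs0.ne', one_smul, hx]
  have hdet : 0 < |(s⁻¹ • A).det| := abs_pos.2 (left_ne_zero_of_mul_eq_one (det_mul_det_eq_one hBT))
  have hZ := posteriorZ_pos (xt := xt) hG hV hprior hε η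
  set Z := posteriorZ G V₀ xt ε η with hZdef
  set k := |(s⁻¹ • A).det| * stdConst d with hk
  have hk0 : 0 < k := mul_pos hdet (stdConst_pos d)
  -- The multiple of the posterior for which the density ratio is exactly e^W: k matches the
  -- Gaussian prefactor, and e^(V₀(x†)) makes the offset in W vanish at x†.
  set q : Euc d → ℝ := fun x => k * Real.exp (V₀ xt) * posteriorWeight G V₀ xt ε η x with hq
  have hqpos : ∀ x, 0 < q x := fun x =>
    mul_pos (mul_pos hk0 (Real.exp_pos _)) (posteriorWeight_pos η x)
  have hqm : Measurable q := (continuous_posteriorWeight hG hV η).measurable.const_mul _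
  set a : NNReal := ⟨k * Real.exp (V₀ xt) * Z, by positivity⟩ with ha
  have ha0 : a ≠ 0 := by
    rw [← NNReal.coe_ne_zero]
    exact (by positivity : k * Real.exp (V₀ xt) * Z ≠ 0)
  have h1 : IsProbabilityMeasure ((stdGaussian (Euc d)).map (fun x => m + (s • A') x)) :=
    Measure.isProbabilityMeasure_map (by fun_prop)
  have h2 := isProbabilityMeasure_posterior (xt := xt) hG hV hprior hε η
  have hsm : a • posterior G V₀ xt ε η = volume.withDensity (fun x => ENNReal.ofReal (q x)) := by
    rw [posterior, ← Measure.coe_nnreal_smul, ← withDensity_smul' _ _ (by simp)]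
    congr 1
    ext x
    simp only [Pi.smul_apply, smul_eq_mul]
    rw [← ENNReal.ofReal_coe_nnreal, ← ENNReal.ofReal_mul (NNReal.coe_nonneg _)]
    congr 1
    change k * Real.exp (V₀ xt) * Z * (_ / Z) = _
    rw [hq]
    field_simp
  have hfin : IsFiniteMeasure (a • posterior G V₀ xt ε η) := inferInstance
  refine (klDiv_le_klDiv_smul_right (μ := posterior G V₀ xt ε η) ha0).trans (le_of_eq ?_)
  rw [hsm] at hfin ⊢
  rw [map_stdGaussian_eq_withDensity m hBT] at h1 ⊢
  rw [klDiv_withDensity_ofReal (measurable_gaussDens m _) hqm (gaussDens_nonneg m _) hqpos]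
  refine lintegral_congr fun x => ?_
  congr 1
  set b := s⁻¹ • A (x - xt) with hb
  set g := s⁻¹ • (G x - G xt) with hg
  set W := misfitGap η b g (V₀ x - V₀ xt) with hW
  have hp : gaussDens m (s⁻¹ • A) x = k * Real.exp (-(‖η - b‖ ^ 2 / 2)) := by
    have : (s⁻¹ • A) (x - m) = b - η := by
      have hAA : A (A' η) = η := congrArg (fun L : Euc d →L[ℝ] Euc d => L η) hA'
      rw [hm, ← sub_sub, map_sub]
      change s⁻¹ • A (x - xt) - s⁻¹ • A (s • A' η) = b - η
      rw [map_smul, hAA, smul_smul, inv_mul_cancel₀ hs0.ne', one_smul]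
    rw [gaussDens, this, norm_sub_rev, hk, mul_assoc]
    congr 3
    ring
  have hqx : q x = k * Real.exp (-(‖η - b‖ ^ 2 / 2)) * Real.exp (-W) := by
    have hd : data G xt ε η - G x = s • (η - g) := by
      rw [data, hg, smul_sub, smul_smul, mul_inv_cancel₀ hs0.ne', one_smul]
      abel
    rw [hq]
    simp only [posteriorWeight]
    rw [hd, norm_smul, Real.norm_of_nonneg hs0.le, mul_pow, hs2, mul_assoc k,
      mul_assoc k, ← Real.exp_add, ← Real.exp_add, hW, misfitGap]
    congr 2
    field_simp
    ring
  have hratio : gaussDens m (s⁻¹ • A) x / q x = Real.exp W := by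
    rw [hp, hqx, Real.exp_neg W]
    field_simp
  have hdi : Real.exp (‖η‖ ^ 2 / 2) * divIntegrand G V₀ xt s η x =
      Real.exp (-(‖η - b‖ ^ 2 / 2)) * (Real.exp (-W) - 1 + W) := by
    rw [divIntegrand, ← mul_assoc, ← Real.exp_add]
    congr 2
    ring
  rw [hratio, hqx, mul_assoc k (Real.exp (‖η‖ ^ 2 / 2)), hdi, klFun_apply, Real.log_exp]
  have : Real.exp (-W) * Real.exp W = 1 := by rw [← Real.exp_add]; simp
  linear_combination (k * Real.exp (-(‖η - b‖ ^ 2 / 2)) * (W - 1)) * this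

/-- Only an inequality, so that the integrand f needs no measurability. -/
lemma lintegral_stdGaussian_le {f : Euc d → ℝ≥0∞} :
    ∫⁻ η, f η ∂(stdGaussian (Euc d)) ≤
      ∫⁻ η, ENNReal.ofReal (stdConst d * Real.exp (-(1 / 2) * ‖η‖ ^ 2)) * f η := by
  rw [stdGaussian_eq_withDensity]
  exact lintegral_withDensity_le_lintegral_mul _ (by fun_prop) _

lemma lintegral_ofReal_add_exp {c b z a₁ a₂ c' : ℝ} (hc : 0 < c) (hc' : 0 < c') (hb : 0 < b)
    (ha₁ : 0 ≤ a₁) (ha₂ : 0 ≤ a₂) {h : Euc d → ℝ} (hh : Integrable h) (hh0 : ∀ x, 0 ≤ h x)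
    (hz : ∫ x, h x = z) (y : Euc d) :
    ∫⁻ η : Euc d, ∫⁻ x : Euc d, ENNReal.ofReal
      (a₁ * (Real.exp (-c * ‖η‖ ^ 2) * Real.exp (-c' * ‖x - y‖ ^ 2)) +
        a₂ * (Real.exp (-b * ‖η‖ ^ 2) * h x)) =
    ENNReal.ofReal (a₁ * ((Real.pi / c) ^ ((d : ℝ) / 2) * (Real.pi / c') ^ ((d : ℝ) / 2)) +
      a₂ * ((Real.pi / b) ^ ((d : ℝ) / 2) * z)) := by
  have hz0 : 0 ≤ z := hz ▸ integral_nonneg hh0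
  have hi : Integrable fun x : Euc d => Real.exp (-c' * ‖x - y‖ ^ 2) :=
    (integrable_exp_neg_mul_sq_norm hc').comp_sub_right y
  have hval : ∫ x : Euc d, Real.exp (-c' * ‖x - y‖ ^ 2) = (Real.pi / c') ^ ((d : ℝ) / 2) := by
    rw [integral_sub_right_eq_self (fun x : Euc d => Real.exp (-c' * ‖x‖ ^ 2)) y,
      integral_exp_neg_mul_sq_norm hc']
  have hin : ∀ η : Euc d, ∫⁻ x : Euc d, ENNReal.ofReal
      (a₁ * (Real.exp (-c * ‖η‖ ^ 2) * Real.exp (-c' * ‖x - y‖ ^ 2)) +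
        a₂ * (Real.exp (-b * ‖η‖ ^ 2) * h x)) = ENNReal.ofReal
      (a₁ * (Real.pi / c') ^ ((d : ℝ) / 2) * Real.exp (-c * ‖η‖ ^ 2) +
        a₂ * z * Real.exp (-b * ‖η‖ ^ 2)) := by
    intro η
    have i1 : Integrable fun x : Euc d =>
      a₁ * (Real.exp (-c * ‖η‖ ^ 2) * Real.exp (-c' * ‖x - y‖ ^ 2)) :=
      (hi.const_mul _).const_mul _
    have i2 : Integrable fun x : Euc d => a₂ * (Real.exp (-b * ‖η‖ ^ 2) * h x) :=
      (hh.const_mul _).const_mul _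
    have i3 : Integrable fun x : Euc d =>
        a₁ * (Real.exp (-c * ‖η‖ ^ 2) * Real.exp (-c' * ‖x - y‖ ^ 2)) +
          a₂ * (Real.exp (-b * ‖η‖ ^ 2) * h x) := i1.add i2
    rw [← ofReal_integral_eq_lintegral_ofReal i3 (ae_of_all _ fun x => ?_),
      integral_add i1 i2, integral_const_mul, integral_const_mul, integral_const_mul,
      integral_const_mul, hval, hz]
    · congr 1
      ring
    · have := hh0 x
      positivity
  simp_rw [hin]
  have j1 := (integrable_exp_neg_mul_sq_norm (d := d) hc).const_mul
    (a₁ * (Real.pi / c') ^ ((d : ℝ) / 2))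
  have j2 := (integrable_exp_neg_mul_sq_norm (d := d) hb).const_mul (a₂ * z)
  have j3 : Integrable fun η : Euc d =>
      a₁ * (Real.pi / c') ^ ((d : ℝ) / 2) * Real.exp (-c * ‖η‖ ^ 2) +
        a₂ * z * Real.exp (-b * ‖η‖ ^ 2) := j1.add j2
  rw [← ofReal_integral_eq_lintegral_ofReal j3 (ae_of_all _ fun x => by positivity),
    integral_add j1 j2, integral_const_mul, integral_const_mul, integral_exp_neg_mul_sq_norm hc,
    integral_exp_neg_mul_sq_norm hb]
  congr 1
  ring

lemma abs_det_smul (s : ℝ) (A : Euc d →L[ℝ] Euc d) :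
    |(s • A).det| = |s| ^ d * |A.det| := by
  have h : (s • A).det = s ^ d * A.det := by
    have := LinearMap.det_smul s (A : Euc d →ₗ[ℝ] Euc d)
    rwa [finrank_euclideanSpace_fin] at this
  rw [h, abs_mul, abs_pow]

lemma pi_div_div_sq_rpow {c s : ℝ} (hc : 0 < c) (hs : 0 < s) (d : ℕ) :
    (Real.pi / (c / s ^ 2)) ^ ((d : ℝ) / 2) = (Real.pi / c) ^ ((d : ℝ) / 2) * s ^ d := by
  have h1 : Real.pi / (c / s ^ 2) = Real.pi / c * s ^ 2 := by field_simp
  have h2 : (s ^ 2) ^ ((d : ℝ) / 2) = s ^ d := by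
    rw [← Real.rpow_natCast s 2, ← Real.rpow_mul hs.le, ← Real.rpow_natCast s d]
    congr 1
    push_cast
    ring
  rw [h1, Real.mul_rpow (by positivity) (by positivity), h2]

lemma exists_inv_pow_mul_exp_le (d : ℕ) {κ : ℝ} (hκ : 0 < κ) :
    ∃ C : ℝ, 0 < C ∧ ∀ s : ℝ, 0 < s → s ≤ 1 →
      s⁻¹ ^ d * Real.exp (-(κ / s ^ 2)) ≤ C * s ^ 2 := by
  obtain ⟨C, hC, h⟩ := exists_one_add_pow_le_mul_exp (d + 1) hκ
  refine ⟨C, hC, fun s hs hs1 => ?_⟩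
  have hs2 : 0 < s ^ 2 := by positivity
  have h1 : 1 ≤ s⁻¹ := (one_le_inv₀ hs).2 hs1
  have h2 : s⁻¹ ≤ 1 + (s ^ 2)⁻¹ := by
    rw [← inv_pow]
    nlinarith
  have h3 : s⁻¹ ^ d * (s ^ 2)⁻¹ ≤ C * Real.exp (κ / s ^ 2) := by
    refine le_trans ?_ (h (s ^ 2)⁻¹ (by positivity))
    rw [pow_succ (1 + (s ^ 2)⁻¹)]
    have h4 : 0 < (s ^ 2)⁻¹ := inv_pos.2 hs2
    exact mul_le_mul (pow_le_pow_left₀ (inv_nonneg.2 hs.le) h2 d) (by linarith) h4.le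
      (pow_nonneg (by linarith) d)
  calc s⁻¹ ^ d * Real.exp (-(κ / s ^ 2))
      = s⁻¹ ^ d * (s ^ 2)⁻¹ * Real.exp (-(κ / s ^ 2)) * s ^ 2 := by field_simp
    _ ≤ C * Real.exp (κ / s ^ 2) * Real.exp (-(κ / s ^ 2)) * s ^ 2 := by gcongr
    _ = C * s ^ 2 := by rw [mul_assoc C, ← Real.exp_add, add_neg_cancel, Real.exp_zero, mul_one]

/-- The determinant contributes s^(-d). In the near term it cancels the s^d from integrating the
Gaussian of width s; in the far term it stays, to be beaten by exp(-κ/s²). -/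
lemma lintegral_klDiv_linearised_le (hG : Continuous G) (hV : Continuous V₀)
    (hprior : Integrable (fun x => Real.exp (-V₀ x)) volume)
    {A' : Euc d →L[ℝ] Euc d} (hA' : fderiv ℝ G xt * A' = 1) {C c κ s : ℝ}
    (hC : 0 < C) (hc : 0 < c) (hs : 0 < s)
    (h : ∀ η x, divIntegrand G V₀ xt s η x ≤
      C * s ^ 2 * (Real.exp (-c * ‖η‖ ^ 2) * Real.exp (-(c / s ^ 2) * ‖x - xt‖ ^ 2)) +
      C * Real.exp (-(κ / s ^ 2)) * (Real.exp (-(1 / 8) * ‖η‖ ^ 2) * Real.exp (-V₀ x))) :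
    ∫⁻ η, klDiv ((stdGaussian (Euc d)).map (fun x => (xt + s • A' η) + (s • A') x))
        (posterior G V₀ xt (s ^ 2) η) ∂(stdGaussian (Euc d)) ≤
      ENNReal.ofReal (C * stdConst d ^ 2 * |(fderiv ℝ G xt).det| *
        (((Real.pi / c) ^ ((d : ℝ) / 2)) ^ 2 * s ^ 2 +
          (Real.pi / (1 / 8)) ^ ((d : ℝ) / 2) * (∫ x, Real.exp (-V₀ x)) *
            (s⁻¹ ^ d * Real.exp (-(κ / s ^ 2))))) := by
  have hsq : Real.sqrt (s ^ 2) = s := Real.sqrt_sq hs.le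
  have hσ := stdConst_pos d
  set σ := stdConst d with hσd
  set k := |(s⁻¹ • fderiv ℝ G xt).det| * σ with hk
  have hk0 : 0 ≤ k := by positivity
  calc _ ≤ ∫⁻ η : Euc d, ENNReal.ofReal (σ * Real.exp (-(1 / 2) * ‖η‖ ^ 2)) *
        ∫⁻ x, ENNReal.ofReal (k * Real.exp (‖η‖ ^ 2 / 2) * divIntegrand G V₀ xt s η x) := by
        refine lintegral_stdGaussian_le.trans (lintegral_mono fun η => ?_)
        have := klDiv_linearised_le (xt := xt) hG hV hprior hA' (pow_pos hs 2) η
        rw [hsq] at this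
        exact mul_le_mul_right this _
    _ ≤ ∫⁻ η : Euc d, ∫⁻ x : Euc d, ENNReal.ofReal
        (σ * k * C * s ^ 2 * (Real.exp (-c * ‖η‖ ^ 2) *
            Real.exp (-(c / s ^ 2) * ‖x - xt‖ ^ 2)) +
          σ * k * C * Real.exp (-(κ / s ^ 2)) *
            (Real.exp (-(1 / 8) * ‖η‖ ^ 2) * Real.exp (-V₀ x))) := by
        refine lintegral_mono fun η => ?_
        rw [← lintegral_const_mul' _ _ ENNReal.ofReal_ne_top]
        refine lintegral_mono fun x => ?_
        rw [← ENNReal.ofReal_mul (by positivity)]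
        refine ENNReal.ofReal_le_ofReal ?_
        -- `divIntegrand` already carries the noise density's exponential, so the two factors here
        -- cancel.
        have h1 : Real.exp (-(1 / 2) * ‖η‖ ^ 2) * Real.exp (‖η‖ ^ 2 / 2) = 1 := by
          rw [← Real.exp_add, show -(1 / 2) * ‖η‖ ^ 2 + ‖η‖ ^ 2 / 2 = 0 by ring, Real.exp_zero]
        calc σ * Real.exp (-(1 / 2) * ‖η‖ ^ 2) *
              (k * Real.exp (‖η‖ ^ 2 / 2) * divIntegrand G V₀ xt s η x)
            = σ * k * (Real.exp (-(1 / 2) * ‖η‖ ^ 2) * Real.exp (‖η‖ ^ 2 / 2)) *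
              divIntegrand G V₀ xt s η x := by ring
          _ = σ * k * divIntegrand G V₀ xt s η x := by rw [h1, mul_one]
          _ ≤ σ * k * _ := mul_le_mul_of_nonneg_left (h η x) (by positivity)
          _ = _ := by ring
    _ = _ := by
        rw [lintegral_ofReal_add_exp hc (by positivity) (by norm_num) (by positivity)
          (by positivity) hprior (fun x => (Real.exp_pos _).le) rfl, pi_div_div_sq_rpow hc hs,
          hk, abs_det_smul, abs_of_pos (inv_pos.2 hs)]
        congr 1
        have hsd : s⁻¹ ^ d * s ^ d = 1 := by
          rw [← mul_pow, inv_mul_cancel₀ hs.ne', one_pow]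
        linear_combination (σ ^ 2 * |(fderiv ℝ G xt).det| * C * s ^ 2 *
          ((Real.pi / c) ^ ((d : ℝ) / 2)) ^ 2) * hsd

end Main

end GaussianKL

end

theorem theorem5p2 (d : ℕ)
    (G : GaussianKL.Euc d → GaussianKL.Euc d) (V₀ : GaussianKL.Euc d → ℝ)
    (xt : GaussianKL.Euc d)
    -- the forward map
    (hG : ContDiff ℝ 4 G)
    (hGinj : ∀ x, G x = G xt → x = xt)
    (hGdiffeo : IsLocalDiffeomorphAt 𝓘(ℝ, GaussianKL.Euc d) 𝓘(ℝ, GaussianKL.Euc d) 1 G xt)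
    -- the prior, with density proportional to `exp (-V₀)`
    (hV : ContDiff ℝ 2 V₀)
    (hprior : Integrable (fun x => Real.exp (-V₀ x)) volume)
    -- growth and coercivity of the potentials `|G(x†) - G(x)|² / 2` and `V₀`
    (hgrowth : ∃ M : ℝ, 0 < M ∧ ∀ x,
      (1 / 2) * ‖G xt - G x‖ ^ 2 ≤ M * Real.exp (‖x‖ ^ 2) ∧
      |V₀ x| ≤ M * Real.exp (‖x‖ ^ 2))
    (hcoercive : ∃ c₀ c₁ : ℝ, 0 < c₀ ∧ 0 < c₁ ∧ ∀ x,
      -c₀ + c₁ * ‖x‖ ^ 2 ≤ (1 / 2) * ‖G xt - G x‖ ^ 2) :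
    ∃ C : ℝ, 0 < C ∧ ∃ ε₀ : ℝ, 0 < ε₀ ∧ ∀ ε : ℝ, 0 < ε → ε < ε₀ →
      ∀ ν : GaussianKL.Euc d → Measure (GaussianKL.Euc d),
        (∀ η, GaussianKL.IsBestGaussian (ν η) (GaussianKL.posterior G V₀ xt ε η)) →
        Measurable (fun η => klDiv (ν η) (GaussianKL.posterior G V₀ xt ε η)) ∧
        ∫⁻ η, klDiv (ν η) (GaussianKL.posterior G V₀ xt ε η) ∂(stdGaussian (GaussianKL.Euc d))
          ≤ ENNReal.ofReal (C * ε) := by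
  obtain ⟨A', hA₁, hA₂⟩ := GaussianKL.exists_inverse_fderiv hGdiffeo
  obtain ⟨C, c, κ, s₀, hC, hc, hκ, hs₀, hs₀1, hbound⟩ := GaussianKL.exists_divIntegrand_le
    (hG.of_le (by norm_num)) hGinj hA₂ (hV.of_le (by norm_num)) hgrowth hcoercive
  obtain ⟨D, hD, hDs⟩ := GaussianKL.exists_inv_pow_mul_exp_le d hκ
  have hZ : 0 ≤ ∫ x, Real.exp (-V₀ x) := integral_nonneg fun x => (Real.exp_pos _).le
  set L := C * GaussianKL.stdConst d ^ 2 * |(fderiv ℝ G xt).det| with hL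
  have hL0 : 0 ≤ L := by positivity
  set I₁ := ((Real.pi / c) ^ ((d : ℝ) / 2)) ^ 2 with hI₁
  set I₂ := (Real.pi / (1 / 8)) ^ ((d : ℝ) / 2) * ∫ x, Real.exp (-V₀ x) with hI₂
  have hI₁0 : 0 ≤ I₁ := by positivity
  have hI₂0 : 0 ≤ I₂ := by positivity
  -- The summand 1 gives strict positivity from nonnegative terms; s₀ bounds s = √ε, hence the
  -- square.
  refine ⟨L * (I₁ + I₂ * D) + 1, by positivity, s₀ ^ 2, by positivity, ?_⟩
  intro ε hε hεs ν hν
  refine ⟨GaussianKL.measurable_klDiv_of_isBestGaussian hG.continuous hV.continuous hprior hε hν,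
    ?_⟩
  obtain ⟨s, hs, rfl⟩ : ∃ s : ℝ, 0 < s ∧ s ^ 2 = ε :=
    ⟨Real.sqrt ε, Real.sqrt_pos.2 hε, Real.sq_sqrt hε.le⟩
  have hss : s < s₀ := lt_of_pow_lt_pow_left₀ 2 hs₀.le hεs
  refine (lintegral_mono fun η => (hν η).2 _
    (GaussianKL.map_stdGaussian_mem_gaussianMeasures (xt + s • A' η) (s • A'))).trans ?_
  refine (GaussianKL.lintegral_klDiv_linearised_le hG.continuous hV.continuous hprior hA₁ hC hc hs
    (hbound s hs hss)).trans (ENNReal.ofReal_le_ofReal ?_)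
  calc L * (I₁ * s ^ 2 + I₂ * (s⁻¹ ^ d * Real.exp (-(κ / s ^ 2))))
      ≤ L * (I₁ * s ^ 2 + I₂ * (D * s ^ 2)) := by
        have := hDs s hs (hss.le.trans hs₀1)
        gcongr
    _ ≤ (L * (I₁ + I₂ * D) + 1) * s ^ 2 := by nlinarith [sq_nonneg s]
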